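/- Lemma 3.1. Let $G=(V,E)$ be an infinite, connected, locally finite graph (simple and undirected) which is quasitransitive ($\mathrm{Aut}(G)$ has finitely many orbits on $V$) and amenable: there is an increasing sequence $(G_n)$ of finite connected induced subgraphs with $\bigcup_n G_n=G$ and $|\partial G_n|/|V(G_n)|\to 0$, where $\partial H$ denotes the set of vertices of $H$ adjacent in $G$ to a vertex outside $H$. An essential spanning forest of $G$ is a spanning subgraph of $G$ all of whose components are trees with infinitely many vertices; let $\Omega$ be the set of essential spanning forests, with the smallest $\sigma$-algebra for which all maps $F\mapsto F_H$ ($H$ a subgraph of $G$, $F_H$ the set of edges of $F$ contained in $H$) are measurable. A probability measure $\mu$ on $\Omega$ has the weak Gibbs property if for every finite induced subgraph $H$ of $G$ the following holds. For $a,b\in\partial H$ write $a\sim_I b$ if $a$ and $b$ are joined by a path of edges of $F_H$. Then, conditionally on $F_{G\setminus H}$ (the edges of $F$ not contained in $H$) and on the relation $\sim_I$, all spanning forests of $H$ which induce this relation on $\partial H$ and each of whose components contains a vertex of $\partial H$ are equally likely to be $F_H$. The number of topological ends of an infinite tree is the maximal number of pairwise disjoint semi-infinite paths in it. Let $\mu$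 be a probability measure on $\Omega$ that has the weak Gibbs property, and suppose that $\mu$-almost surely every tree of $F$ has exactly one topological end. Then $\mu=\mu_G$, where $\mu_G$ is the probability measure on $\Omega$ which, for every increasing sequence $(G_n)$ of finite connected induced subgraphs of $G$ with $\bigcup_n G_n=G$, is the weak limit (as measures on $\{0,1\}^{E}$) of the uniform measures on spanning trees of $G_n$. -/

import Mathlib

open MeasureTheory ProbabilityTheory Filter Topology

noncomputable section

namespace SpanningForest

/-- A spanning subgraph of `G`, given by the indicator function of its set of edges.  The space of
spanning subgraphs carries the product topology and the product `σ`-algebra. -/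
abbrev Config {V : Type*} (G : SimpleGraph V) : Type _ := G.edgeSet → Bool

/-- The graph on `V` whose edges are the edges of `G` that are present in `ω`. -/
def toGraph {V : Type*} {G : SimpleGraph V} (ω : Config G) : SimpleGraph V :=
  SimpleGraph.fromEdgeSet {e | ∃ h : e ∈ G.edgeSet, ω ⟨e, h⟩ = true}

/-- The edges of the subgraph of `G` induced by `S`: both endpoints lie in `S`. -/
def inside {V : Type*} (G : SimpleGraph V) (S : Finset V) : Set G.edgeSet :=
  {e | ∀ v ∈ (e : Sym2 V), v ∈ S}

open Classical in
/-- The edges of `ω` that belong to `D` (as a spanning subgraph: all other edges are removed). -/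
def restrictTo {V : Type*} {G : SimpleGraph V} (D : Set G.edgeSet) (ω : Config G) : Config G :=
  fun e => if e ∈ D then ω e else false

/-- The vertices of `S` that are adjacent in `G` to a vertex outside of `S`. -/
def boundary {V : Type*} (G : SimpleGraph V) (S : Finset V) : Set V :=
  {v | v ∈ S ∧ ∃ w, w ∉ S ∧ G.Adj v w}

/-! ### Essential spanning forests -/

/-- Spanning subgraphs all of whose components are trees with infinitely many vertices. -/
def IsEssentialSpanningForest {V : Type*} {G : SimpleGraph V} (ω : Config G) : Prop :=
  (toGraph ω).IsAcyclic ∧ ∀ c : (toGraph ω).ConnectedComponent, c.supp.Infinite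

/-- The space of essential spanning forests of `G`, with the `σ`-algebra generated by the
restrictions of a forest to the edges of `G` (the trace of the product `σ`-algebra). -/
abbrev Forests {V : Type*} (G : SimpleGraph V) : Type _ :=
  {ω : Config G // IsEssentialSpanningForest ω}

/-- A semi-infinite (self-avoiding) path in the graph `F`. -/
def IsRay {V : Type*} (F : SimpleGraph V) (r : ℕ → V) : Prop :=
  Function.Injective r ∧ ∀ n, F.Adj (r n) (r (n + 1))

/-- The number of topological ends of a component `c` (a tree) of `F`: the maximal number of
pairwise disjoint semi-infinite paths in `c`. -/
def numEnds {V : Type*} (F : SimpleGraph V) (c : F.ConnectedComponent) : ℕ∞ :=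
  ⨆ (R : Set (ℕ → V)) (_ : (∀ r ∈ R, IsRay F r ∧ Set.range r ⊆ c.supp) ∧
    R.PairwiseDisjoint Set.range), R.encard

/-! ### The weak Gibbs property -/

/-- The relation `∼_I` on the boundary of `S`: two boundary vertices are related if they are joined
by a path of `ω` inside the subgraph induced by `S`. -/
def innerRel {V : Type*} {G : SimpleGraph V} (S : Finset V) (ω : Config G) : Set (V × V) :=
  {p | p.1 ∈ boundary G S ∧ p.2 ∈ boundary G S ∧
    (toGraph (restrictTo (inside G S) ω)).Reachable p.1 p.2}

/-- `A` is a spanning forest of the subgraph of `G` induced by `S`, and each of its components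
contains a vertex of the boundary of `S`. -/
def IsBoundaryForest {V : Type*} {G : SimpleGraph V} (S : Finset V) (A : Config G) : Prop :=
  (∀ e, A e = true → e ∈ inside G S) ∧ (toGraph A).IsAcyclic ∧
    ∀ v ∈ S, ∃ b ∈ boundary G S, (toGraph A).Reachable v b

/-- The `σ`-algebra generated by the edges of `F` outside the subgraph `H` induced by `S` (those
without both endpoints in `S`) and by the relation `∼_I` on the boundary of `H`. -/
abbrev outerSigma {V : Type*} (G : SimpleGraph V) (S : Finset V) : MeasurableSpace (Forests G) :=
  MeasurableSpace.comap (fun F : Forests G => restrictTo (inside G S)ᶜ F.1) inferInstance ⊔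
    MeasurableSpace.comap (fun F : Forests G => innerRel S F.1) ⊤

/-- The weak Gibbs property: for each finite induced subgraph `H`, conditionally on `F` outside `H`
and on the relation `∼_I`, all spanning forests of `H` that touch the boundary with each component
and give this relation are equally likely to be the restriction of `F` to `H`. -/
def WeakGibbs {V : Type*} {G : SimpleGraph V} (μ : Measure (Forests G)) : Prop :=
  ∀ (S : Finset V) (A B : Config G), IsBoundaryForest S A → IsBoundaryForest S B →
    innerRel S A = innerRel S B →
    μ⟦{F : Forests G | restrictTo (inside G S) F.1 = A} | outerSigma G S⟧ =ᵐ[μ]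
      μ⟦{F : Forests G | restrictTo (inside G S) F.1 = B} | outerSigma G S⟧

/-! ### Exhaustions, amenability, quasitransitivity -/

/-- An increasing sequence of finite connected induced subgraphs with union `G`. -/
structure IsExhaustion {V : Type*} (G : SimpleGraph V) (S : ℕ → Finset V) : Prop where
  mono : Monotone S
  connected : ∀ n, (G.induce (S n : Set V)).Connected
  covers : ∀ v, ∃ n, v ∈ S n

/-- Amenability: some exhaustion satisfies `|∂ G_n| / |V(G_n)| → 0`. -/
def IsAmenable {V : Type*} (G : SimpleGraph V) : Prop :=
  ∃ S : ℕ → Finset V, IsExhaustion G S ∧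
    Tendsto (fun n => ((boundary G (S n)).ncard : ℝ) / ((S n).card : ℝ)) atTop (𝓝 0)

/-- The automorphism group of `G` has finitely many orbits of vertices. -/
def IsQuasitransitive {V : Type*} (G : SimpleGraph V) : Prop :=
  ∃ R : Finset V, ∀ v, ∃ r ∈ R, ∃ φ : G ≃g G, φ r = v

/-! ### The measure `μ_G` -/

/-- The spanning trees of the subgraph of `G` induced by `S`. -/
def spanningTrees {V : Type*} (G : SimpleGraph V) (S : Finset V) : Set (Config G) :=
  {T | (∀ e, T e = true → e ∈ inside G S) ∧ ((toGraph T).induce (S : Set V)).IsTree}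

theorem finite_inside {V : Type*} (G : SimpleGraph V) (S : Finset V) : (inside G S).Finite := by
  classical
  refine Set.Finite.of_finite_image (f := Subtype.val) (S.sym2.finite_toSet.subset ?_)
    Subtype.val_injective.injOn
  rintro _ ⟨e, he, rfl⟩
  exact Finset.mem_coe.2 (Finset.mem_sym2_iff.2 he)

theorem finite_spanningTrees {V : Type*} (G : SimpleGraph V) (S : Finset V) :
    (spanningTrees G S).Finite := by
  classical
  have := (finite_inside G S).to_subtype
  refine Set.Finite.of_finite_image (f := fun T (e : inside G S) => T e.1)
    (Set.toFinite _) ?_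
  intro T hT U hU hTU
  funext e
  by_cases he : e ∈ inside G S
  · exact congrFun hTU ⟨e, he⟩
  · have h1 : T e = false := by
      by_contra h; exact he (hT.1 e (by simpa using h))
    have h2 : U e = false := by
      by_contra h; exact he (hU.1 e (by simpa using h))
    rw [h1, h2]

theorem nonempty_spanningTrees {V : Type*} (G : SimpleGraph V) (S : Finset V)
    (hS : (G.induce (S : Set V)).Connected) : (spanningTrees G S).Nonempty := by
  classical
  obtain ⟨T, hTG, hT⟩ := hS.exists_isTree_le
  refine ⟨fun e => decide ((e : Sym2 V) ∈ (T.map (Function.Embedding.subtype _)).edgeSet),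
    ?_, ?_⟩
  · rintro ⟨e, he⟩ h
    induction e with
    | _ a b =>
      simp only [decide_eq_true_eq, SimpleGraph.mem_edgeSet, SimpleGraph.map_adj] at h
      obtain ⟨u, v, -, rfl, rfl⟩ := h
      intro w hw
      simp only [Function.Embedding.subtype_apply, Sym2.mem_iff] at hw
      rcases hw with rfl | rfl
      · exact u.2
      · exact v.2
  · convert hT
    ext u v
    simp only [SimpleGraph.comap_adj, toGraph, SimpleGraph.fromEdgeSet_adj, Set.mem_ofPred_eq,
      decide_eq_true_eq, SimpleGraph.mem_edgeSet, SimpleGraph.map_adj,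
      Function.Embedding.subtype_apply]
    constructor
    · rintro ⟨⟨-, a, b, hab, h1, h2⟩, -⟩
      rwa [Subtype.ext h1, Subtype.ext h2] at hab
    · intro h
      exact ⟨⟨hTG h, u, v, h, rfl, rfl⟩, fun huv => h.ne (Subtype.ext huv)⟩

/-- The uniform measure on the spanning trees of the connected subgraph of `G` induced by `S`. -/
def uniformSpanningTree {V : Type*} [Countable V] (G : SimpleGraph V) (S : Finset V)
    (hS : (G.induce (S : Set V)).Connected) : ProbabilityMeasure (Config G) :=
  ⟨uniformOn (spanningTrees G S),
    isProbabilityMeasure_uniformOn (finite_spanningTrees G S) (nonempty_spanningTrees G S hS)⟩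

/-- `ν` is the weak limit of the uniform measures on spanning trees of `G_n`, for every increasing
sequence `G_n` of finite connected induced subgraphs with union `G`. -/
def IsUSTLimit {V : Type*} [Countable V] {G : SimpleGraph V}
    (ν : ProbabilityMeasure (Forests G)) : Prop :=
  ∀ (S : ℕ → Finset V) (hS : IsExhaustion G S),
    Tendsto (fun n => uniformSpanningTree G (S n) (hS.connected n)) atTop
      (𝓝 (ν.map (f := Subtype.val) measurable_subtype_coe.aemeasurable))

open Classical in
/-- The measure `μ_G`: the weak limit of the uniform spanning tree measures of the `G_n` (with the
value zero if there were no such limit). -/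
def muG {V : Type*} [Countable V] (G : SimpleGraph V) : Measure (Forests G) :=
  if h : ∃ ν : ProbabilityMeasure (Forests G), IsUSTLimit ν then (h.choose : Measure (Forests G))
  else 0

end SpanningForest

end

/-!
A forest whose trees are infinite with one end is the same as a map `n : V → V` that sends each
vertex to its neighbour in the direction of the end of its tree (`IsEndMap`, `exists_next`).  Call a
finite set `D` *escaped* if no path towards the end that starts outside of `D` enters `D`.  Each
finite set `K` is contained in an escaped one, namely in the set of the descendants of `K`, which is
finite since the trees have one end (`IsEndMap.exists_mem_escape`).  Whether `D` is escaped depends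
only on the edges that do not touch `D`, because it means that the forest without the edges that
touch `D` still has infinite components outside of `D` (`IsEndMap.mem_escape_iff`); the union of two
escaped sets is escaped.  Therefore the largest escaped subset of a large finite set `T` can be
found by looking at the forest from outside, and it contains `K` with probability close to one.

If `D` is escaped, then the edges that touch `D` form a spanning tree of `D` with the complement of
`D` contracted to a point, and every such tree can be glued to the outside without changing which
boundary vertices of a slightly larger set are connected inside that set (`innerRel_glue`).  By the
weak Gibbs property all these trees are equally likely (`WeakGibbs.real_inter_tree_eq`).  Hence `μ`
is locally close to uniform spanning trees of large finite sets with wired boundary conditions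
(`WeakGibbs.real_avoid_eq`).

It remains to see that the free and the wired uniform spanning trees have the same limit.  By the
matrix-tree theorem (`det_lap`) the probability that a uniform spanning tree avoids a finite set `A`
of edges is `det (1 - Y)`, where `Y` is the restriction to `A` of the inverse of the Laplacian, the
Green form (`card_parents_sdiff`).  By the variational principle (`le_green`, `exists_eq_green`) the
wired form increases with the set, the free form decreases, and the former is bounded by the latter.
The trace of the Green form is the number of edges of a spanning tree, so the traces of the free and
of the wired form of `S` differ by at most the size of the boundary of `S` (`sum_gap_le`).  In an
amenable quasitransitive graph the orbit of each edge meets the sets of an exhaustion in a positive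
proportion of their size, so the difference of the two forms vanishes in the limit
(`exists_gap_lt`, `tendsto_gap`), and the probabilities to avoid `A` have the same limit for both
boundary conditions (`exists_limit_avoid`).  These probabilities determine a measure on
configurations and its weak convergence (`tendsto_of_tendsto_avoid`).
-/

noncomputable section

namespace SpanningForest

open scoped Classical

/-! ### The matrix-tree theorem -/

/-- The signed incidence vector of an edge, for an arbitrary choice of its orientation; it is zero
on loops. -/
def incidence {V : Type*} (e : Sym2 V) (v : V) : ℝ :=
  (if v = (Quot.out e).1 then 1 else 0) - (if v = (Quot.out e).2 then 1 else 0)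

/-- The Laplacian of the graph with edges `E`, with Dirichlet boundary conditions outside of `D`:
the vertices outside of `D` are contracted to a root, whose row and column are removed. -/
def lap {V : Type*} (E : Finset (Sym2 V)) (D : Finset V) : Matrix D D ℝ :=
  Matrix.of fun u v => ∑ e ∈ E, incidence e u * incidence e v

/-- The neighbours of `v` in the graph with edges `E`. -/
def nbrs {V : Type*} (E : Finset (Sym2 V)) (v : V) : Finset V :=
  (E.biUnion Sym2.toFinset).filter fun w => s(v, w) ∈ E

/-- The extension of a map `p` on `D` to all vertices, by the identity outside of `D`. -/
def step {V : Type*} {D : Finset V} (p : D → V) (v : V) : V :=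
  if h : v ∈ D then p ⟨v, h⟩ else v

/-- Every vertex leaves `D` when `p` is iterated. -/
def Leaves {V : Type*} {D : Finset V} (p : D → V) : Prop :=
  ∀ v, ∃ k, (step p)^[k] v ∉ D

/-- The parent functions of the spanning trees of the graph with edges `E` and the complement of
`D` contracted to a root: each vertex of `D` is sent to its neighbour in the direction of the
root. -/
def parents {V : Type*} (E : Finset (Sym2 V)) (D : Finset V) : Finset (D → V) :=
  (Fintype.piFinset fun v : D => nbrs E v).filter Leaves

section MatrixTree

variable {V : Type*} {E : Finset (Sym2 V)} {D : Finset V}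

theorem mem_nbrs {v w : V} : w ∈ nbrs E v ↔ s(v, w) ∈ E := by
  simp only [nbrs, Finset.mem_filter, Finset.mem_biUnion, Sym2.mem_toFinset, and_iff_right_iff_imp]
  exact fun h => ⟨_, h, Sym2.mem_mk_right _ _⟩

theorem mem_parents {p : D → V} : p ∈ parents E D ↔ (∀ v : D, s((v : V), p v) ∈ E) ∧ Leaves p := by
  simp [parents, mem_nbrs]

theorem step_of_mem {p : D → V} {v : V} (h : v ∈ D) : step p v = p ⟨v, h⟩ := dif_pos h

theorem step_of_notMem {p : D → V} {v : V} (h : v ∉ D) : step p v = v := dif_neg h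

theorem incidence_of_notMem {e : Sym2 V} {v : V} (h : v ∉ e) : incidence e v = 0 := by
  have h1 : v ≠ (Quot.out e).1 := by rintro rfl; exact h (Sym2.out_fst_mem e)
  have h2 : v ≠ (Quot.out e).2 := by rintro rfl; exact h (Sym2.out_snd_mem e)
  simp [incidence, h1, h2]

theorem incidence_mk_or (v w : V) :
    (∀ u, incidence s(v, w) u = (if u = v then 1 else 0) - (if u = w then 1 else 0)) ∨
    (∀ u, incidence s(v, w) u = (if u = w then 1 else 0) - (if u = v then 1 else 0)) := by
  have h : s((Quot.out s(v, w)).1, (Quot.out s(v, w)).2) = s(v, w) := Quot.out_eq s(v, w)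
  rcases Sym2.eq_iff.1 h with ⟨h1, h2⟩ | ⟨h1, h2⟩
  · left; intro u; rw [incidence, h1, h2]
  · right; intro u; rw [incidence, h1, h2]

theorem incidence_mk_mul (v w u : V) :
    incidence s(v, w) v * incidence s(v, w) u =
      (if v = u then 1 else 0) - (if w = u then 1 else 0) := by
  rcases incidence_mk_or v w with h | h <;> rw [h, h] <;> by_cases h1 : v = w <;>
    by_cases h2 : v = u <;> by_cases h3 : w = u <;> simp_all [eq_comm]

theorem lap_row (u v : D) :
    lap E D u v = ∑ w ∈ nbrs E u,
      ((if (u : V) = v then 1 else 0) - (if w = (v : V) then 1 else 0) : ℝ) := by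
  have hE : E.filter (fun e => (u : V) ∈ e) = (nbrs E u).image fun w => s((u : V), w) := by
    ext e
    simp only [Finset.mem_filter, Finset.mem_image, mem_nbrs]
    constructor
    · rintro ⟨he, hu⟩
      obtain ⟨w, rfl⟩ := hu
      exact ⟨w, he, rfl⟩
    · rintro ⟨w, hw, rfl⟩
      exact ⟨hw, Sym2.mem_mk_left _ _⟩
  have h1 : lap E D u v = ∑ e ∈ E.filter (fun e => (u : V) ∈ e), incidence e u * incidence e v := by
    rw [Finset.sum_filter_of_ne]
    · rfl
    · intro e _ h
      by_contra hu
      simp [incidence_of_notMem hu] at h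
  rw [h1, hE, Finset.sum_image]
  · exact Finset.sum_congr rfl fun w _ => incidence_mk_mul _ _ _
  · intro a _ b _ h
    exact Sym2.congr_right.1 h

theorem iterate_step_notMem {p : D → V} {v : V} {j k : ℕ} (hjk : j ≤ k)
    (h : (step p)^[j] v ∉ D) : (step p)^[k] v ∉ D := by
  induction k, hjk using Nat.le_induction with
  | base => exact h
  | succ k _ ih => rwa [Function.iterate_succ_apply', step_of_notMem ih]

/-- The number of steps until `v` leaves `D`. -/
def depth {p : D → V} (hp : Leaves p) (v : V) : ℕ := Nat.find (hp v)

theorem depth_lt {p : D → V} (hp : Leaves p) {v : V} (hv : v ∈ D) :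
    depth hp (p ⟨v, hv⟩) < depth hp v := by
  have h0 : depth hp v ≠ 0 := fun h => by
    have := Nat.find_spec (hp v)
    rw [show Nat.find (hp v) = 0 from h] at this
    exact this hv
  obtain ⟨k, hk⟩ := Nat.exists_eq_succ_of_ne_zero h0
  have h1 : (step p)^[k] (p ⟨v, hv⟩) ∉ D := by
    have := Nat.find_spec (hp v)
    rw [show Nat.find (hp v) = k + 1 from hk, Function.iterate_succ_apply, step_of_mem hv] at this
    exact this
  have : depth hp (p ⟨v, hv⟩) ≤ k := Nat.find_le h1
  omega

/-- A map with `f` decreasing along it on `D` leaves `D`. -/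
theorem leaves_of_lt {p : D → V} (f : V → ℕ) (h : ∀ v : D, f (p v) < f v) : Leaves p := by
  intro v
  induction hn : f v using Nat.strong_induction_on generalizing v with
  | _ n ih =>
    by_cases hv : v ∈ D
    · have := h ⟨v, hv⟩
      obtain ⟨k, hk⟩ := ih _ (hn ▸ this) _ rfl
      exact ⟨k + 1, by rwa [Function.iterate_succ_apply, step_of_mem hv]⟩
    · exact ⟨0, hv⟩

/-- The terms of the expansion of the determinant in `det_lap`: the Laplacian of a directed graph
with one outgoing edge at each vertex of `D` is unimodular if there are no cycles, and otherwise
singular. -/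
theorem det_parent (p : D → V) :
    Matrix.det (Matrix.of fun u v : D =>
      ((if (u : V) = v then 1 else 0) - (if p u = (v : V) then 1 else 0) : ℝ)) =
      if Leaves p then 1 else 0 := by
  split_ifs with hp
  · -- Ordered by decreasing depth, the matrix is triangular with unit diagonal.
    rw [Matrix.BlockTriangular.det (b := fun v : D => OrderDual.toDual (depth hp v))]
    · refine Finset.prod_eq_one fun a _ => ?_
      refine (congrArg Matrix.det ?_).trans Matrix.det_one
      ext u v
      have huv : depth hp u.1 = depth hp v.1 := by
        have h1 := u.2; have h2 := v.2
        exact OrderDual.toDual.injective (h1.trans h2.symm)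
      have hne : p u.1 ≠ (v.1 : V) := by
        intro h
        have := depth_lt hp u.1.2
        rw [Subtype.coe_eta, h] at this
        omega
      simp only [Matrix.toSquareBlock_def, Matrix.of_apply, hne, if_false, sub_zero,
        Matrix.one_apply, Subtype.ext_iff]
    · intro u v huv
      have h : depth hp u < depth hp v := huv
      have h1 : u ≠ v := by rintro rfl; omega
      have h2 : p u ≠ v := by
        intro h'
        have := depth_lt hp u.2
        rw [Subtype.coe_eta, h'] at this
        omega
      simp [h1, h2]
  · -- The indicator function of the vertices that never leave `D` is in the kernel.
    have hp' : ∃ v, ∀ k, (step p)^[k] v ∈ D := by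
      simpa [Leaves] using hp
    obtain ⟨v, hv⟩ := hp'
    refine Matrix.exists_mulVec_eq_zero_iff.1
      ⟨fun u => if ∀ k, (step p)^[k] (u : V) ∈ D then 1 else 0, ?_, ?_⟩
    · intro h
      have := congrFun h ⟨v, hv 0⟩
      simp [hv] at this
    · ext u
      simp only [Matrix.mulVec, dotProduct, Matrix.of_apply, sub_mul, Finset.sum_sub_distrib,
        Pi.zero_apply]
      have hu : (∀ k, (step p)^[k] (u : V) ∈ D) ↔ ∀ k, (step p)^[k] (p u) ∈ D := by
        constructor
        · intro h k
          have := h (k + 1)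
          rwa [Function.iterate_succ_apply, step_of_mem u.2] at this
        · intro h k
          cases k with
          | zero => exact u.2
          | succ k => rw [Function.iterate_succ_apply, step_of_mem u.2]; exact h k
      rw [Finset.sum_eq_single u]
      · by_cases hpu : p u ∈ D
        · rw [Finset.sum_eq_single ⟨p u, hpu⟩]
          · simp [hu]
          · intro b _ hb
            have : p u ≠ b := fun h => hb (Subtype.ext h.symm)
            simp [this]
          · simp
        · rw [Finset.sum_eq_zero]
          · have : ¬ ∀ k, (step p)^[k] (u : V) ∈ D := fun h => hpu (hu.1 h 0)
            simp [this]
          · intro b _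
            have : p u ≠ b := fun h => hpu (h ▸ b.2)
            simp [this]
      · intro b _ hb
        have : (u : V) ≠ b := fun h => hb (Subtype.ext h.symm)
        simp [this]
      · simp

/-- **The matrix-tree theorem**: the determinant of the Laplacian counts spanning trees.  Expand
the determinant along all rows at once: the terms are indexed by maps that send each vertex of `D`
to a neighbour, and the acyclic ones contribute one. -/
theorem det_lap : (lap E D).det = (parents E D).card := by
  have h : lap E D = fun u : D => ∑ w ∈ nbrs E u, fun v : D =>
      ((if (u : V) = v then 1 else 0) - (if w = (v : V) then 1 else 0) : ℝ) := by
    ext u v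
    rw [lap_row, Finset.sum_apply]
  have h2 := (Matrix.detRowAlternating (R := ℝ) (n := D)).toMultilinearMap.map_sum_finset
    (fun (u : D) (w : V) (v : D) =>
      ((if (u : V) = v then 1 else 0) - (if w = (v : V) then 1 else 0) : ℝ))
    (fun u : D => nbrs E u)
  rw [h]
  refine h2.trans ?_
  rw [parents, Finset.card_filter]
  push_cast
  exact Finset.sum_congr rfl fun p _ => det_parent p

end MatrixTree

/-! ### The Dirichlet energy and the Green form -/

/-- The difference of the values of `f` at the endpoints of the edge `e`, for the orientation used
in `incidence`. -/
def grad {V : Type*} (f : V → ℝ) (e : Sym2 V) : ℝ := f (Quot.out e).1 - f (Quot.out e).2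

/-- The Dirichlet energy of `f` on the edges `E`. -/
def energy {V : Type*} (E : Finset (Sym2 V)) (f : V → ℝ) : ℝ := ∑ e ∈ E, grad f e ^ 2

/-- The bilinear form of the inverse of the Laplacian `lap E D`, which is invertible if the graph has
a spanning tree (`isUnit_det_lap`). -/
def green {V : Type*} (E : Finset (Sym2 V)) (D : Finset V) (x y : V → ℝ) : ℝ :=
  (fun v : D => x v) ⬝ᵥ ((lap E D)⁻¹).mulVec fun v : D => y v

section Green

variable {V : Type*} {E E' : Finset (Sym2 V)} {D D' S S' : Finset V}

theorem grad_mk_sq (f : V → ℝ) (v w : V) : grad f s(v, w) ^ 2 = (f v - f w) ^ 2 := by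
  have h : s((Quot.out s(v, w)).1, (Quot.out s(v, w)).2) = s(v, w) := Quot.out_eq s(v, w)
  rcases Sym2.eq_iff.1 h with ⟨h1, h2⟩ | ⟨h1, h2⟩ <;> rw [grad, h1, h2]
  ring

theorem energy_nonneg (f : V → ℝ) : 0 ≤ energy E f := Finset.sum_nonneg fun _ _ => sq_nonneg _

theorem energy_mono (h : E ⊆ E') (f : V → ℝ) : energy E f ≤ energy E' f :=
  Finset.sum_le_sum_of_subset_of_nonneg h fun _ _ _ => sq_nonneg _

theorem energy_eq_of_agree {f : V → ℝ} (hf : ∀ v ∉ D, f v = 0)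
    (h : ∀ e, (∃ v ∈ e, v ∈ D) → (e ∈ E ↔ e ∈ E')) : energy E f = energy E' f := by
  have key : ∀ E : Finset (Sym2 V),
      energy E f = ∑ e ∈ E.filter (fun e => ∃ v ∈ e, v ∈ D), grad f e ^ 2 := by
    intro E
    rw [Finset.sum_filter_of_ne]
    · rfl
    · intro e _ he
      by_contra hD
      push Not at hD
      rw [grad, hf _ (hD _ (Sym2.out_fst_mem e)), hf _ (hD _ (Sym2.out_snd_mem e))] at he
      simp at he
  rw [key E, key E']
  congr 1
  ext e
  simp only [Finset.mem_filter]
  exact and_congr_left fun he => h e he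

theorem sum_incidence_mul {f : V → ℝ} (hf : ∀ v ∉ D, f v = 0) (e : Sym2 V) :
    ∑ v ∈ D, incidence e v * f v = grad f e := by
  simp only [incidence, sub_mul, Finset.sum_sub_distrib, ite_mul, one_mul, zero_mul,
    Finset.sum_ite_eq', grad]
  congr 1 <;> split_ifs with h <;> simp_all

theorem lap_transpose : (lap E D).transpose = lap E D := by
  ext u v
  exact Finset.sum_congr rfl fun e _ => mul_comm _ _

theorem lap_inv_transpose : ((lap E D)⁻¹).transpose = (lap E D)⁻¹ := by
  rw [Matrix.transpose_nonsing_inv, lap_transpose]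

theorem green_comm (x y : V → ℝ) : green E D x y = green E D y x := by
  rw [green, Matrix.dotProduct_mulVec, ← Matrix.mulVec_transpose, lap_inv_transpose,
    dotProduct_comm, green]

theorem green_add_left (x y z : V → ℝ) :
    green E D (x + y) z = green E D x z + green E D y z := by
  simp only [green, Pi.add_apply]
  rw [← add_dotProduct]
  rfl

theorem green_neg_left (x z : V → ℝ) : green E D (-x) z = -green E D x z := by
  simp only [green, Pi.neg_apply]
  rw [← neg_dotProduct]
  rfl

theorem green_add_right (x y z : V → ℝ) :
    green E D z (x + y) = green E D z x + green E D z y := by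
  rw [green_comm, green_add_left, green_comm x, green_comm y]

theorem green_neg_right (x z : V → ℝ) : green E D z (-x) = -green E D z x := by
  rw [green_comm, green_neg_left, green_comm x]

theorem energy_eq_dotProduct {f : V → ℝ} (hf : ∀ v ∉ D, f v = 0) :
    energy E f = (fun v : D => f v) ⬝ᵥ (lap E D).mulVec fun v : D => f v := by
  have h : ∀ e, grad f e = ∑ v : D, incidence e v * f v := fun e => by
    rw [← sum_incidence_mul hf e, ← Finset.sum_coe_sort D]
  simp only [energy, h, dotProduct, Matrix.mulVec, lap, Matrix.of_apply, Finset.sum_mul,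
    Finset.mul_sum, sq]
  rw [Finset.sum_comm]
  refine Finset.sum_congr rfl fun u _ => ?_
  rw [Finset.sum_comm]
  refine Finset.sum_congr rfl fun v _ => Finset.sum_congr rfl fun e _ => by ring

theorem isUnit_det_lap (h : (parents E D).Nonempty) : IsUnit (lap E D).det := by
  rw [det_lap, isUnit_iff_ne_zero]
  exact_mod_cast h.card_pos.ne'

/-- The extension by zero of a function on `D`. -/
def extend {V : Type*} {D : Finset V} (g : D → ℝ) (v : V) : ℝ :=
  if h : v ∈ D then g ⟨v, h⟩ else 0

theorem extend_of_notMem (g : D → ℝ) : ∀ v ∉ D, extend g v = 0 := fun _ h => dif_neg h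

theorem extend_coe (g : D → ℝ) : (fun v : D => extend g v) = g := by
  ext v
  exact dif_pos v.2

theorem lap_mulVec_inv (h : (parents E D).Nonempty) (x : D → ℝ) :
    (lap E D).mulVec ((lap E D)⁻¹.mulVec x) = x := by
  rw [Matrix.mulVec_mulVec, Matrix.mul_nonsing_inv _ (isUnit_det_lap h), Matrix.one_mulVec]

/-- **The variational principle** (Dirichlet's and Thomson's): `green E D x x` is the maximum of
`2 ⟨x, f⟩ - energy E f` over the functions `f` that vanish outside of `D`. -/
theorem le_green (h : (parents E D).Nonempty) (x : V → ℝ) {f : V → ℝ} (hf : ∀ v ∉ D, f v = 0) :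
    2 * ∑ v ∈ D, x v * f v - energy E f ≤ green E D x x := by
  set g : D → ℝ := (lap E D)⁻¹.mulVec fun v : D => x v with hg
  have hLg : (lap E D).mulVec g = fun v : D => x v := lap_mulVec_inv h _
  have h0 := energy_nonneg (E := E) (f - extend g)
  rw [energy_eq_dotProduct (D := D) (fun v hv => by
    simp [hf v hv, extend_of_notMem g v hv])] at h0
  have h1 : (fun v : D => (f - extend g) v) = (fun v : D => f v) - g := by
    conv_rhs => rw [← extend_coe g]
    rfl
  rw [h1, Matrix.mulVec_sub, sub_dotProduct, dotProduct_sub, dotProduct_sub,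
    ← energy_eq_dotProduct hf, hLg] at h0
  have h2 : g ⬝ᵥ (lap E D).mulVec (fun v : D => f v) = (fun v : D => f v) ⬝ᵥ fun v : D => x v := by
    rw [Matrix.dotProduct_mulVec, ← Matrix.mulVec_transpose, lap_transpose, hLg, dotProduct_comm]
  have h3 : ∑ v ∈ D, x v * f v = (fun v : D => f v) ⬝ᵥ fun v : D => x v := by
    rw [← Finset.sum_coe_sort D, dotProduct_comm]
    rfl
  have h4 : green E D x x = g ⬝ᵥ fun v : D => x v := by rw [green, dotProduct_comm]
  rw [h2] at h0
  linarith

theorem exists_eq_green (h : (parents E D).Nonempty) (x : V → ℝ) :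
    ∃ f : V → ℝ, (∀ v ∉ D, f v = 0) ∧
      2 * ∑ v ∈ D, x v * f v - energy E f = green E D x x := by
  set g : D → ℝ := (lap E D)⁻¹.mulVec fun v : D => x v with hg
  have hLg : (lap E D).mulVec g = fun v : D => x v := lap_mulVec_inv h _
  refine ⟨extend g, extend_of_notMem g, ?_⟩
  rw [energy_eq_dotProduct (extend_of_notMem g), extend_coe, hLg]
  have h3 : ∑ v ∈ D, x v * extend g v = (fun v : D => x v) ⬝ᵥ g := by
    rw [← Finset.sum_coe_sort D]
    conv_rhs => rw [← extend_coe g]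
    rfl
  rw [h3, dotProduct_comm g, green]
  ring

theorem green_self_nonneg (h : (parents E D).Nonempty) (x : V → ℝ) : 0 ≤ green E D x x := by
  have := le_green h x (f := 0) (fun _ _ => rfl)
  simpa [energy, grad] using this

theorem green_incidence_le_one (h : (parents E D).Nonempty) {e : Sym2 V} (he : e ∈ E) :
    green E D (incidence e) (incidence e) ≤ 1 := by
  obtain ⟨f, hf, hfe⟩ := exists_eq_green h (incidence e)
  rw [← hfe, sum_incidence_mul hf]
  have : grad f e ^ 2 ≤ energy E f :=
    Finset.single_le_sum (f := fun e => grad f e ^ 2) (fun _ _ => sq_nonneg _) he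
  nlinarith [sq_nonneg (grad f e - 1)]

/-- Rayleigh monotonicity for the wired boundary conditions. -/
theorem green_le_of_subset (h : (parents E D).Nonempty) (h' : (parents E' D').Nonempty)
    (hD : D ⊆ D') (hE : ∀ e, (∃ v ∈ e, v ∈ D) → (e ∈ E ↔ e ∈ E')) (x : V → ℝ) :
    green E D x x ≤ green E' D' x x := by
  obtain ⟨f, hf, hfe⟩ := exists_eq_green h x
  rw [← hfe, energy_eq_of_agree hf hE, Finset.sum_subset hD fun v _ hv => by simp [hf v hv]]
  exact le_green h' x fun v hv => hf v fun h => hv (hD h)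

/-- The variational principle for the free boundary conditions: if all edges lie in `S`, the root
`r` is immaterial, and the test functions are unrestricted. -/
theorem le_green_erase {r : V} (h : (parents E (S.erase r)).Nonempty)
    (hE : ∀ e ∈ E, ∀ v ∈ e, v ∈ S) {x : V → ℝ} (hx : ∑ v ∈ S, x v = 0) (f : V → ℝ) :
    2 * ∑ v ∈ S, x v * f v - energy E f ≤ green E (S.erase r) x x := by
  have h1 := le_green h x (f := fun v => if v ∈ S then f v - f r else 0) (fun v hv => by
    simp only [Finset.mem_erase, not_and] at hv
    by_cases hvr : v = r
    · simp [hvr]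
    · simp [hv hvr])
  have h2 : energy E (fun v => if v ∈ S then f v - f r else 0) = energy E f := by
    refine Finset.sum_congr rfl fun e he => ?_
    simp [grad, hE e he _ (Sym2.out_fst_mem e), hE e he _ (Sym2.out_snd_mem e)]
  have h3 : ∑ v ∈ S.erase r, x v * (if v ∈ S then f v - f r else 0) = ∑ v ∈ S, x v * f v := by
    rw [Finset.sum_erase _ (by simp)]
    rw [Finset.sum_congr rfl (g := fun v => x v * f v - x v * f r) fun v hv => by
      rw [if_pos hv]; ring]
    rw [Finset.sum_sub_distrib, ← Finset.sum_mul, hx]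
    ring
  rwa [h2, h3] at h1

theorem exists_eq_green_erase {r : V} (h : (parents E (S.erase r)).Nonempty) (x : V → ℝ) :
    ∃ f : V → ℝ, 2 * ∑ v ∈ S, x v * f v - energy E f = green E (S.erase r) x x := by
  obtain ⟨f, hf, hfe⟩ := exists_eq_green h x
  refine ⟨f, ?_⟩
  rw [← hfe, Finset.sum_erase _ (by simp [hf r])]

/-- Rayleigh monotonicity for the free boundary conditions. -/
theorem green_erase_le {r r' : V} (h : (parents E (S.erase r)).Nonempty)
    (h' : (parents E' (S'.erase r')).Nonempty) (hS : S ⊆ S') (hEE : E ⊆ E')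
    (hE : ∀ e ∈ E, ∀ v ∈ e, v ∈ S) {x : V → ℝ} (hx : ∑ v ∈ S, x v = 0)
    (hx0 : ∀ v ∉ S, x v = 0) :
    green E' (S'.erase r') x x ≤ green E (S.erase r) x x := by
  obtain ⟨f, hf⟩ := exists_eq_green_erase h' x
  have h1 := le_green_erase h hE hx f
  have h2 := energy_mono hEE f
  rw [Finset.sum_subset hS fun v _ hv => by simp [hx0 v hv]] at h1
  linarith

/-- The wired form is bounded by the free form. -/
theorem green_le_green_erase {r : V} (h : (parents E (S.erase r)).Nonempty)
    (h' : (parents E' D).Nonempty) (hDS : D ⊆ S) (hE : ∀ e ∈ E, ∀ v ∈ e, v ∈ S)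
    (hEE : ∀ e, (∃ v ∈ e, v ∈ D) → (e ∈ E' ↔ e ∈ E)) {x : V → ℝ} (hx : ∑ v ∈ S, x v = 0) :
    green E' D x x ≤ green E (S.erase r) x x := by
  obtain ⟨f, hf, hfe⟩ := exists_eq_green h' x
  rw [← hfe, energy_eq_of_agree hf hEE, Finset.sum_subset hDS fun v _ hv => by simp [hf v hv]]
  exact le_green_erase h hE hx f

theorem sum_incidence {e : Sym2 V} (he : ∀ v ∈ e, v ∈ S) : ∑ v ∈ S, incidence e v = 0 := by
  simp [incidence, Finset.sum_sub_distrib, he _ (Sym2.out_fst_mem e), he _ (Sym2.out_snd_mem e)]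

/-- The form at an incidence vector does not depend on the orientation. -/
theorem green_incidence_mk (v w : V) :
    green E D (incidence s(v, w)) (incidence s(v, w)) =
      green E D (Pi.single v 1 - Pi.single w 1) (Pi.single v 1 - Pi.single w 1) := by
  rcases incidence_mk_or v w with h | h
  · have : incidence s(v, w) = Pi.single v 1 - Pi.single w 1 := by
      ext u
      rw [h]
      simp [Pi.single_apply]
    rw [this]
  · have : incidence s(v, w) = -(Pi.single v 1 - Pi.single w 1) := by
      ext u
      rw [h]
      simp [Pi.single_apply]
    rw [this, green_neg_left, green_neg_right, neg_neg]

theorem green_le_of_equiv (φ : V ≃ V) (h : (parents E D).Nonempty) (h' : (parents E' D').Nonempty)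
    (hE : ∀ a b, s(φ a, φ b) ∈ E' ↔ s(a, b) ∈ E) (hD : ∀ v, φ v ∈ D' ↔ v ∈ D) {x x' : V → ℝ}
    (hx : ∀ v, x' (φ v) = x v) : green E D x x ≤ green E' D' x' x' := by
  obtain ⟨f, hf, hfe⟩ := exists_eq_green h x
  have h1 := le_green h' x' (f := f ∘ φ.symm) (fun v hv => hf _ fun h => hv (by
    simpa using (hD _).2 h))
  have h2 : ∑ v ∈ D', x' v * (f ∘ φ.symm) v = ∑ v ∈ D, x v * f v := by
    symm
    refine Finset.sum_bij (fun v _ => φ v) (fun v hv => (hD v).2 hv) (fun _ _ _ _ h =>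
      φ.injective h) (fun v hv => ⟨φ.symm v, (hD _).1 (by simpa using hv), by simp⟩) ?_
    intro v _
    simp [hx]
  have h3 : energy E' (f ∘ φ.symm) = energy E f := by
    symm
    refine Finset.sum_bij (fun e _ => Sym2.map φ e) ?_ (fun _ _ _ _ h =>
      Sym2.map.injective φ.injective h) ?_ ?_
    · intro e he
      induction e with | _ a b => exact (hE a b).2 he
    · intro e he
      induction e with | _ a b =>
        exact ⟨s(φ.symm a, φ.symm b), (hE _ _).1 (by simpa using he), by simp⟩
    · intro e _
      induction e with | _ a b => simp [grad_mk_sq]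
  rw [h2, h3] at h1
  linarith

theorem green_eq_of_equiv (φ : V ≃ V) (h : (parents E D).Nonempty) (h' : (parents E' D').Nonempty)
    (hE : ∀ a b, s(φ a, φ b) ∈ E' ↔ s(a, b) ∈ E) (hD : ∀ v, φ v ∈ D' ↔ v ∈ D) {x x' : V → ℝ}
    (hx : ∀ v, x' (φ v) = x v) : green E D x x = green E' D' x' x' :=
  (green_le_of_equiv φ h h' hE hD hx).antisymm (green_le_of_equiv φ.symm h' h
    (fun a b => by rw [← hE]; simp) (fun v => by rw [← hD]; simp) fun v => by rw [← hx]; simp)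

/-- The diagonal controls the off-diagonal entries of the difference of two forms that are ordered
at `x + y` and at `x - y`. -/
theorem abs_green_sub_le {x y : V → ℝ}
    (h1 : green E D (x + y) (x + y) ≤ green E' D' (x + y) (x + y))
    (h2 : green E D (x + -y) (x + -y) ≤ green E' D' (x + -y) (x + -y)) :
    |green E' D' x y - green E D x y| ≤
      ((green E' D' x x - green E D x x) + (green E' D' y y - green E D y y)) / 2 := by
  simp only [green_add_left, green_add_right, green_neg_left, green_neg_right] at h1 h2
  rw [green_comm y x, green_comm (E := E') y x] at h1 h2
  rw [abs_le]
  constructor <;> linarith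

theorem green_polarization (x y : V → ℝ) :
    green E D x y = (green E D (x + y) (x + y) - green E D (x + -y) (x + -y)) / 4 := by
  simp only [green_add_left, green_add_right, green_neg_left, green_neg_right]
  rw [green_comm y x]
  ring

theorem green_add_self_le (h : (parents E D).Nonempty) (x y : V → ℝ) :
    green E D (x + y) (x + y) ≤ 2 * green E D x x + 2 * green E D y y := by
  have := green_self_nonneg h (x + -y)
  simp only [green_add_left, green_add_right, green_neg_left, green_neg_right] at this ⊢
  linarith

/-- The trace of the Green form: the expected number of edges of a spanning tree. -/
theorem sum_green_incidence (h : (parents E D).Nonempty) :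
    ∑ e ∈ E, green E D (incidence e) (incidence e) = D.card := by
  have h1 : ((lap E D)⁻¹ * lap E D).trace = D.card := by
    rw [Matrix.nonsing_inv_mul _ (isUnit_det_lap h), Matrix.trace_one, Fintype.card_coe]
  rw [← h1, Matrix.trace]
  simp only [green, dotProduct, Matrix.mulVec, Matrix.diag, Matrix.mul_apply, Finset.mul_sum]
  rw [Finset.sum_comm]
  refine Finset.sum_congr rfl fun u _ => ?_
  rw [Finset.sum_comm]
  refine Finset.sum_congr rfl fun v _ => ?_
  rw [lap, Matrix.of_apply, Finset.mul_sum]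
  exact Finset.sum_congr rfl fun e _ => by ring

/-- The probability that the spanning tree avoids `A` is a determinant of the Green form. -/
theorem card_parents_sdiff (h : (parents E D).Nonempty) {A : Finset (Sym2 V)} (hA : A ⊆ E) :
    ((parents (E \ A) D).card : ℝ) = (parents E D).card *
      (1 - Matrix.of fun e f : A => green E D (incidence e) (incidence f)).det := by
  set X : Matrix D A ℝ := Matrix.of fun v e => incidence (e : Sym2 V) v with hX
  have h1 : lap (E \ A) D = lap E D * (1 - (lap E D)⁻¹ * X * X.transpose) := by
    rw [mul_sub, mul_one, Matrix.mul_assoc, Matrix.mul_nonsing_inv_cancel_left _ _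
      (isUnit_det_lap h), eq_sub_iff_add_eq]
    ext u v
    simp only [Matrix.add_apply, lap, Matrix.of_apply, Matrix.mul_apply, hX,
      Matrix.transpose_apply]
    rw [Finset.sum_coe_sort A fun e => incidence e (u : V) * incidence e (v : V),
      Finset.sum_sdiff hA]
  have h2 : X.transpose * ((lap E D)⁻¹ * X) =
      Matrix.of fun e f : A => green E D (incidence e) (incidence f) := by
    ext e f
    simp only [Matrix.mul_apply, green, dotProduct, Matrix.mulVec, hX, Matrix.transpose_apply,
      Matrix.of_apply]
  rw [← det_lap, ← det_lap, h1, Matrix.det_mul, Matrix.det_one_sub_mul_comm, h2]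

end Green

/-! ### Free and wired boundary conditions in an amenable graph -/

section Amenable

variable {V : Type*} {G : SimpleGraph V}

/-- The edges of `G` with both endpoints in `S`. -/
def insideEdges (G : SimpleGraph V) (S : Finset V) : Finset (Sym2 V) :=
  S.sym2.filter (· ∈ G.edgeSet)

theorem mem_insideEdges {S : Finset V} {e : Sym2 V} :
    e ∈ insideEdges G S ↔ e ∈ G.edgeSet ∧ ∀ v ∈ e, v ∈ S := by
  rw [insideEdges, Finset.mem_filter, Finset.mem_sym2_iff, and_comm]

/-- The edges of `G` with an endpoint in `D`. -/
def touchingEdges (hfin : ∀ v, (G.neighborSet v).Finite) (D : Finset V) : Finset (Sym2 V) :=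
  D.biUnion fun v => (hfin v).toFinset.image fun w => s(v, w)

theorem mem_touchingEdges {hfin : ∀ v, (G.neighborSet v).Finite} {D : Finset V} {e : Sym2 V} :
    e ∈ touchingEdges hfin D ↔ e ∈ G.edgeSet ∧ ∃ v ∈ e, v ∈ D := by
  simp only [touchingEdges, Finset.mem_biUnion, Finset.mem_image, Set.Finite.mem_toFinset,
    SimpleGraph.mem_neighborSet]
  constructor
  · rintro ⟨v, hv, w, hw, rfl⟩
    exact ⟨hw, v, Sym2.mem_mk_left _ _, hv⟩
  · rintro ⟨he, v, ⟨w, rfl⟩, hD⟩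
    exact ⟨v, hD, w, he, rfl⟩

theorem exists_adj_dist_lt {v o : V} (h : G.Reachable v o) (hne : v ≠ o) :
    ∃ w, G.Adj v w ∧ G.dist w o < G.dist v o := by
  obtain ⟨p, hp⟩ := h.exists_walk_length_eq_dist
  cases p with
  | nil => exact absurd rfl hne
  | cons hvw q =>
    refine ⟨_, hvw, ?_⟩
    have := SimpleGraph.dist_le q
    rw [SimpleGraph.Walk.length_cons] at hp
    omega

theorem nonempty_parents_touchingEdges [Infinite V] (hconn : G.Connected)
    (hfin : ∀ v, (G.neighborSet v).Finite) (D : Finset V) :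
    (parents (touchingEdges hfin D) D).Nonempty := by
  obtain ⟨o, ho⟩ := Infinite.exists_notMem_finset D
  have h : ∀ v : D, ∃ w, G.Adj v w ∧ G.dist w o < G.dist v o := fun v =>
    exists_adj_dist_lt (hconn v o) fun h => ho (h ▸ v.2)
  choose p hp hlt using h
  exact ⟨p, mem_parents.2 ⟨fun v => mem_touchingEdges.2 ⟨hp v, v, Sym2.mem_mk_left _ _, v.2⟩,
    leaves_of_lt (fun v => G.dist v o) hlt⟩⟩

theorem nonempty_parents_insideEdges {S : Finset V} (hS : (G.induce (S : Set V)).Connected) {r : V}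
    (hr : r ∈ S) : (parents (insideEdges G S) (S.erase r)).Nonempty := by
  set o : (S : Set V) := ⟨r, hr⟩ with ho
  have hmem : ∀ v : S.erase r, (v : V) ∈ S := fun v => Finset.mem_of_mem_erase v.2
  have h : ∀ v : S.erase r, ∃ w : (S : Set V), (G.induce (S : Set V)).Adj ⟨v, hmem v⟩ w ∧
      (G.induce (S : Set V)).dist w o < (G.induce (S : Set V)).dist ⟨v, hmem v⟩ o := fun v =>
    exists_adj_dist_lt (hS _ _) fun h => Finset.ne_of_mem_erase v.2 (congrArg Subtype.val h)
  choose p hp hlt using h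
  refine ⟨fun v => p v, mem_parents.2 ⟨fun v => mem_insideEdges.2 ⟨hp v, ?_⟩,
    leaves_of_lt (fun v => if hv : v ∈ S then (G.induce (S : Set V)).dist ⟨v, hv⟩ o else 0) ?_⟩⟩
  · intro w hw
    rcases Sym2.mem_iff.1 hw with rfl | rfl
    · exact hmem v
    · exact (p v).2
  · intro v
    have h1 : ((p v : (S : Set V)) : V) ∈ S := (p v).2
    simp only [dif_pos (hmem v), dif_pos h1]
    exact hlt v

/-- The vertices of `S` all of whose neighbours lie in `S`. -/
def interiorVerts (G : SimpleGraph V) (S : Finset V) : Finset V := S.filter (· ∉ boundary G S)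

theorem mem_of_adj_interiorVerts {S : Finset V} {v w : V} (hv : v ∈ interiorVerts G S)
    (h : G.Adj v w) : w ∈ S := by
  obtain ⟨h1, h2⟩ := Finset.mem_filter.1 hv
  by_contra hw
  exact h2 ⟨h1, w, hw, h⟩

theorem mem_interiorVerts {S : Finset V} {v : V} :
    v ∈ interiorVerts G S ↔ v ∈ S ∧ ∀ w, G.Adj v w → w ∈ S := by
  constructor
  · exact fun h => ⟨(Finset.mem_filter.1 h).1, fun w => mem_of_adj_interiorVerts h⟩
  · rintro ⟨h1, h2⟩
    exact Finset.mem_filter.2 ⟨h1, fun ⟨_, w, hw, hvw⟩ => hw (h2 w hvw)⟩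

theorem interiorVerts_mono {S S' : Finset V} (h : S ⊆ S') :
    interiorVerts G S ⊆ interiorVerts G S' := fun v hv => by
  rw [mem_interiorVerts] at hv ⊢
  exact ⟨h hv.1, fun w hw => h (hv.2 w hw)⟩

theorem card_interiorVerts (S : Finset V) :
    (interiorVerts G S).card + (boundary G S).ncard = S.card := by
  have h : boundary G S = (S.filter (· ∈ boundary G S) : Finset V) := by
    ext v
    simp only [Finset.coe_filter, Set.mem_ofPred_eq]
    exact ⟨fun h => ⟨h.1, h⟩, fun h => h.2⟩
  rw [(congrArg Set.ncard h).trans (Set.ncard_coe_finset _), interiorVerts, add_comm]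
  exact Finset.card_filter_add_card_filter_not _

theorem touchingEdges_interiorVerts_subset (hfin : ∀ v, (G.neighborSet v).Finite) (S : Finset V) :
    touchingEdges hfin (interiorVerts G S) ⊆ insideEdges G S := by
  intro e he
  obtain ⟨he, v, ⟨w, rfl⟩, hv⟩ := mem_touchingEdges.1 he
  refine mem_insideEdges.2 ⟨he, fun u hu => ?_⟩
  rcases Sym2.mem_iff.1 hu with rfl | rfl
  · exact (mem_interiorVerts.1 hv).1
  · exact mem_of_adj_interiorVerts hv he

/-- The Green form of `D` with wired boundary conditions. -/
abbrev wired (hfin : ∀ v, (G.neighborSet v).Finite) (D : Finset V) (x y : V → ℝ) : ℝ :=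
  green (touchingEdges hfin D) D x y

/-- The Green form of `S` with free boundary conditions; the root `r` is immaterial at vectors of
total mass zero. -/
abbrev free (G : SimpleGraph V) (S : Finset V) (r : V) (x y : V → ℝ) : ℝ :=
  green (insideEdges G S) (S.erase r) x y

/-- The difference of the edge probabilities in the uniform spanning tree of `S` and in the uniform
wired spanning tree of the interior of `S`. -/
def gap (hfin : ∀ v, (G.neighborSet v).Finite) (S : Finset V) (r : V) (e : Sym2 V) : ℝ :=
  free G S r (incidence e) (incidence e) -
    wired hfin (interiorVerts G S) (incidence e) (incidence e)

theorem wired_mono [Infinite V] (hconn : G.Connected) (hfin : ∀ v, (G.neighborSet v).Finite)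
    {D D' : Finset V} (h : D ⊆ D') (x : V → ℝ) :
    wired hfin D x x ≤ wired hfin D' x x :=
  green_le_of_subset (nonempty_parents_touchingEdges hconn hfin D)
    (nonempty_parents_touchingEdges hconn hfin D') h (fun _ ⟨v, hv, hD⟩ => by
      simp only [mem_touchingEdges]
      exact and_congr_right fun _ => ⟨fun _ => ⟨v, hv, h hD⟩, fun _ => ⟨v, hv, hD⟩⟩) x

theorem wired_interiorVerts_le [Infinite V] (hconn : G.Connected)
    (hfin : ∀ v, (G.neighborSet v).Finite)
    {S : Finset V} (hS : (G.induce (S : Set V)).Connected) {r : V}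
    (hr : r ∈ S) {x : V → ℝ} (hx : ∑ v ∈ S, x v = 0) :
    wired hfin (interiorVerts G S) x x ≤ free G S r x x :=
  green_le_green_erase (nonempty_parents_insideEdges hS hr)
    (nonempty_parents_touchingEdges hconn hfin _) (Finset.filter_subset _ _)
    (fun _ he => (mem_insideEdges.1 he).2)
    (fun _ he => ⟨fun h => touchingEdges_interiorVerts_subset hfin S h, fun h =>
      mem_touchingEdges.2 ⟨(mem_insideEdges.1 h).1, he⟩⟩) hx

theorem gap_nonneg [Infinite V] (hconn : G.Connected) (hfin : ∀ v, (G.neighborSet v).Finite)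
    {S : Finset V} (hS : (G.induce (S : Set V)).Connected) {r : V}
    (hr : r ∈ S) {e : Sym2 V} (he : ∀ v ∈ e, v ∈ S) : 0 ≤ gap hfin S r e :=
  sub_nonneg.2 (wired_interiorVerts_le hconn hfin hS hr (sum_incidence he))

theorem gap_anti [Infinite V] (hconn : G.Connected) (hfin : ∀ v, (G.neighborSet v).Finite)
    {S S' : Finset V} (hS : (G.induce (S : Set V)).Connected)
    (hS' : (G.induce (S' : Set V)).Connected) (h : S ⊆ S') {r r' : V}
    (hr : r ∈ S) (hr' : r' ∈ S') {e : Sym2 V} (he : ∀ v ∈ e, v ∈ S) :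
    gap hfin S' r' e ≤ gap hfin S r e := by
  refine sub_le_sub ?_ (wired_mono hconn hfin (interiorVerts_mono h) _)
  refine green_erase_le (nonempty_parents_insideEdges hS hr) (nonempty_parents_insideEdges hS' hr')
    h ?_ (fun _ he => (mem_insideEdges.1 he).2) (sum_incidence he)
    fun v hv => incidence_of_notMem fun hve => hv (he v hve)
  intro e he
  rw [mem_insideEdges] at he ⊢
  exact ⟨he.1, fun v hv => h (he.2 v hv)⟩

/-- The expected numbers of edges in the free and the wired spanning tree differ by less than the
size of the boundary. -/
theorem sum_gap_le [Infinite V] (hconn : G.Connected) (hfin : ∀ v, (G.neighborSet v).Finite)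
    {S : Finset V} (hS : (G.induce (S : Set V)).Connected) {r : V}
    (hr : r ∈ S) : ∑ e ∈ insideEdges G S, gap hfin S r e ≤ (boundary G S).ncard := by
  have h1 := sum_green_incidence (nonempty_parents_insideEdges hS hr)
  have h2 := sum_green_incidence (nonempty_parents_touchingEdges hconn hfin (interiorVerts G S))
  have h3 : ∑ e ∈ touchingEdges hfin (interiorVerts G S),
      wired hfin (interiorVerts G S) (incidence e) (incidence e) ≤
      ∑ e ∈ insideEdges G S, wired hfin (interiorVerts G S) (incidence e) (incidence e) :=
    Finset.sum_le_sum_of_subset_of_nonneg (touchingEdges_interiorVerts_subset hfin S)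
      fun e _ _ => green_self_nonneg (nonempty_parents_touchingEdges hconn hfin _) _
  have h4 : ((interiorVerts G S).card : ℝ) + (boundary G S).ncard = S.card := by
    exact_mod_cast card_interiorVerts (G := G) S
  have h5 : ((S.erase r).card : ℝ) ≤ S.card := by exact_mod_cast Finset.card_erase_le
  simp only [gap, Finset.sum_sub_distrib]
  linarith

theorem gap_equiv [Infinite V] (hconn : G.Connected) (hfin : ∀ v, (G.neighborSet v).Finite)
    (φ : G ≃g G) {S S' : Finset V} (hS : (G.induce (S : Set V)).Connected)
    (hS' : (G.induce (S' : Set V)).Connected) (h : ∀ v, φ v ∈ S' ↔ v ∈ S) {r : V} (hr : r ∈ S)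
    (a b : V) : gap hfin S' (φ r) s(φ a, φ b) = gap hfin S r s(a, b) := by
  have hx : ∀ v, (Pi.single (φ a) 1 - Pi.single (φ b) 1 : V → ℝ) (φ v) =
      (Pi.single a 1 - Pi.single b 1 : V → ℝ) v := fun v => by
    simp [Pi.single_apply]
  have hint : ∀ v, φ v ∈ interiorVerts G S' ↔ v ∈ interiorVerts G S := fun v => by
    rw [mem_interiorVerts, mem_interiorVerts, h]
    refine and_congr_right fun _ => ⟨fun H w hw => (h w).1 (H _ (φ.map_adj_iff.2 hw)),
      fun H w hw => ?_⟩
    have := H (φ.symm w) (φ.map_adj_iff.1 (by simpa using hw))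
    simpa using (h _).2 this
  rw [gap, gap, free, free, wired, wired, green_incidence_mk, green_incidence_mk,
    green_incidence_mk, green_incidence_mk]
  congr 1
  · refine (green_eq_of_equiv φ.toEquiv (nonempty_parents_insideEdges hS hr)
      (nonempty_parents_insideEdges hS' ((h r).2 hr)) (fun u v => ?_) (fun v => ?_) hx).symm
    · simp only [mem_insideEdges, SimpleGraph.mem_edgeSet, Sym2.mem_iff, forall_eq_or_imp,
        forall_eq, RelIso.coe_fn_toEquiv, h]
      exact and_congr_left fun _ => φ.map_adj_iff
    · simp [h]
  · refine (green_eq_of_equiv φ.toEquiv (nonempty_parents_touchingEdges hconn hfin _)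
      (nonempty_parents_touchingEdges hconn hfin _) (fun u v => ?_) hint hx).symm
    simp only [mem_touchingEdges, SimpleGraph.mem_edgeSet, Sym2.mem_iff, exists_eq_or_imp,
      exists_eq_left, RelIso.coe_fn_toEquiv, hint]
    exact and_congr_left fun _ => φ.map_adj_iff

theorem finite_walk_ball (hfin : ∀ v, (G.neighborSet v).Finite)
    (v : V) (n : ℕ) : {w | ∃ p : G.Walk v w, p.length ≤ n}.Finite := by
  induction n generalizing v with
  | zero =>
    refine (Set.finite_singleton v).subset ?_
    rintro w ⟨p, hp⟩
    exact (SimpleGraph.Walk.eq_of_length_eq_zero (Nat.le_zero.1 hp)).symm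
  | succ n ih =>
    refine (((hfin v).biUnion fun u _ => ih u).insert v).subset ?_
    rintro w ⟨p, hp⟩
    cases p with
    | nil => exact Set.mem_insert _ _
    | cons h q =>
      refine Set.mem_insert_of_mem _ (Set.mem_biUnion h ⟨q, ?_⟩)
      rw [SimpleGraph.Walk.length_cons] at hp
      omega

/-- A walk that starts in `S` stays in `S` or passes through the boundary of `S`. -/
theorem mem_or_exists_boundary {S : Finset V} {v w : V} (p : G.Walk v w) (hv : v ∈ S) :
    w ∈ S ∨ ∃ u ∈ boundary G S, ∃ q : G.Walk v u, q.length ≤ p.length := by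
  induction p with
  | nil => exact Or.inl hv
  | @cons v x w h p ih =>
    by_cases hx : x ∈ S
    · rcases ih hx with h1 | ⟨u, hu, q, hq⟩
      · exact Or.inl h1
      · exact Or.inr ⟨u, hu, .cons h q, by simpa using hq⟩
    · exact Or.inr ⟨v, ⟨hv, x, hx, h⟩, .nil, by simp⟩

/-- In a quasitransitive graph, the orbit of an edge and the boundary meet every ball of a fixed
radius; hence they are dense in every finite set. -/
theorem card_le_boundary_add_orbit (hconn : G.Connected) (hfin : ∀ v, (G.neighborSet v).Finite)
    (hquasi : IsQuasitransitive G) {a b : V} (hab : G.Adj a b) :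
    ∃ M : ℕ, ∀ S : Finset V, S.card ≤ M * ((boundary G S).ncard +
      (S.filter fun v => ∃ φ : G ≃g G, φ a = v ∧ φ b ∈ S).card) := by
  obtain ⟨R, hR⟩ := hquasi
  have hwalk : ∀ r, ∃ n, ∃ p : G.Walk r a, p.length = n := fun r => by
    obtain ⟨p⟩ := hconn r a
    exact ⟨_, p, rfl⟩
  choose ℓ hℓ using hwalk
  set L := R.sup ℓ with hL
  refine ⟨R.sup fun r => {w | ∃ p : G.Walk r w, p.length ≤ L}.ncard, fun S => ?_⟩
  set M := R.sup fun r => {w | ∃ p : G.Walk r w, p.length ≤ L}.ncard with hM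
  set good := S.filter fun v => ∃ φ : G ≃g G, φ a = v ∧ φ b ∈ S with hgood
  set bd := S.filter (· ∈ boundary G S) with hbd
  have hbdeq : boundary G S = (bd : Finset V) := by
    ext v
    simp only [hbd, Finset.coe_filter, Set.mem_ofPred_eq]
    exact ⟨fun h => ⟨h.1, h⟩, fun h => h.2⟩
  have hball : ∀ u, {w | ∃ p : G.Walk u w, p.length ≤ L}.ncard ≤ M := by
    intro u
    obtain ⟨r, hr, φ, rfl⟩ := hR u
    refine le_trans ?_ (Finset.le_sup (f := fun r => {w | ∃ p : G.Walk r w, p.length ≤ L}.ncard) hr)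
    refine le_trans (Set.ncard_le_ncard (t := φ '' {w | ∃ p : G.Walk r w, p.length ≤ L}) ?_
      ((finite_walk_ball hfin r L).image _)) (Set.ncard_image_le (finite_walk_ball hfin r L))
    rintro w ⟨p, hp⟩
    refine ⟨φ.symm w, ⟨(p.map φ.symm.toHom).copy (by simp) rfl, by simpa using hp⟩, by simp⟩
  have hcover : S ⊆ (bd ∪ good).biUnion fun u => (finite_walk_ball hfin u L).toFinset := by
    intro v hv
    obtain ⟨r, hr, φ, rfl⟩ := hR v
    obtain ⟨p, hp⟩ := hℓ r
    have hpL : p.length ≤ L := hp ▸ Finset.le_sup hr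
    simp only [Finset.mem_biUnion, Finset.mem_union, Set.Finite.mem_toFinset, Set.mem_ofPred_eq]
    rcases mem_or_exists_boundary (p.map φ.toHom) hv with h | ⟨u, hu, q, hq⟩
    · refine ⟨φ a, ?_, (p.map φ.toHom).reverse, by simpa using hpL⟩
      by_cases hb : φ b ∈ S
      · exact Or.inr (Finset.mem_filter.2 ⟨h, φ, rfl, hb⟩)
      · exact Or.inl (Finset.mem_filter.2 ⟨h, h, φ b, hb, φ.map_adj_iff.2 hab⟩)
    · refine ⟨u, Or.inl (Finset.mem_filter.2 ⟨hu.1, hu⟩), q.reverse, ?_⟩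
      rw [SimpleGraph.Walk.length_reverse]
      exact hq.trans (by simpa using hpL)
  calc S.card ≤ _ := Finset.card_le_card hcover
    _ ≤ (bd ∪ good).card * M := Finset.card_biUnion_le_card_mul _ _ _ fun u _ => by
        rw [← Set.ncard_eq_toFinset_card _ (finite_walk_ball hfin u L)]
        exact hball u
    _ ≤ _ := by
        rw [mul_comm, hbdeq, Set.ncard_coe_finset]
        exact Nat.mul_le_mul_left _ (Finset.card_union_le _ _)

theorem IsExhaustion.eventually_subset {S : ℕ → Finset V} (hS : IsExhaustion G S) (K : Finset V) :
    ∀ᶠ n in atTop, K ⊆ S n := by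
  choose n hn using hS.covers
  filter_upwards [eventually_ge_atTop (K.sup n)] with m hm v hv
  exact hS.mono ((Finset.le_sup hv).trans hm) (hn v)

/-- If the gap of an edge did not vanish in the limit, the gaps of the edges in its orbit would
add up to a positive multiple of the volume, and not to the size of the boundary. -/
theorem exists_gap_lt [Infinite V] (hconn : G.Connected) (hfin : ∀ v, (G.neighborSet v).Finite)
    (hamen : IsAmenable G) (hquasi : IsQuasitransitive G) {a b : V}
    (hab : G.Adj a b) {δ : ℝ} (hδ : 0 < δ) :
    ∃ (S : Finset V) (r : V), (G.induce (S : Set V)).Connected ∧ r ∈ S ∧ a ∈ S ∧ b ∈ S ∧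
      gap hfin S r s(a, b) < δ := by
  by_contra! hcon
  obtain ⟨M, hM⟩ := card_le_boundary_add_orbit hconn hfin hquasi hab
  have key : ∀ S : Finset V, (G.induce (S : Set V)).Connected →
      (S.card : ℝ) ≤ M * (1 + 2 / δ) * (boundary G S).ncard := by
    intro S hS
    obtain ⟨⟨r, hr⟩⟩ := hS.nonempty
    have hr : r ∈ S := hr
    -- `good` consists of the images of `a` in `S` whose edge of the orbit of `s(a, b)` is in `S`.
    set good := S.filter fun v => ∃ φ : G ≃g G, φ a = v ∧ φ b ∈ S with hgood
    have hgap : ∀ v ∈ good, ∃ e ∈ insideEdges G S, v ∈ e ∧ δ ≤ gap hfin S r e := by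
      intro v hv
      obtain ⟨hv, φ, rfl, hb⟩ := Finset.mem_filter.1 hv
      refine ⟨s(φ a, φ b), mem_insideEdges.2 ⟨φ.map_adj_iff.2 hab, fun u hu => ?_⟩,
        Sym2.mem_mk_left _ _, ?_⟩
      · rcases Sym2.mem_iff.1 hu with rfl | rfl
        · exact hv
        · exact hb
      · -- The gap of the edge in `S` is the gap of `s(a, b)` in the preimage of `S`.
        set S' : Finset V := S.map φ.symm.toEquiv.toEmbedding with hS'
        have hSS : ∀ u, φ u ∈ S ↔ u ∈ S' := by
          intro u
          simp only [hS', Finset.mem_map_equiv]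
          rfl
        have hconn' : (G.induce (S' : Set V)).Connected := by
          let ψ : G.induce (S' : Set V) ≃g G.induce (S : Set V) :=
            ⟨φ.toEquiv.subtypeEquiv fun u => (hSS u).symm, by
              intro u v
              exact φ.map_adj_iff⟩
          exact ψ.connected_iff.2 hS
        have hr' : φ.symm r ∈ S' := (hSS _).1 (by simpa using hr)
        have h1 := gap_equiv hconn hfin φ hconn' hS hSS hr' a b
        have h2 := hcon S' (φ.symm r) hconn' hr' ((hSS a).1 hv) ((hSS b).1 hb)
        rw [← h1] at h2
        simpa using h2
    have hpos : ∀ e ∈ insideEdges G S, 0 ≤ gap hfin S r e := fun e he =>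
      gap_nonneg hconn hfin hS hr (mem_insideEdges.1 he).2
    -- Each edge is counted at most twice, once for each endpoint.
    have h1 : δ * good.card ≤ 2 * ∑ e ∈ insideEdges G S, gap hfin S r e := by
      calc δ * good.card = ∑ v ∈ good, δ := by simp [mul_comm]
        _ ≤ ∑ v ∈ good, ∑ e ∈ insideEdges G S, if v ∈ e then gap hfin S r e else 0 := by
          refine Finset.sum_le_sum fun v hv => ?_
          obtain ⟨e, he, hve, hδe⟩ := hgap v hv
          refine hδe.trans ?_
          have := Finset.single_le_sum (f := fun e => if v ∈ e then gap hfin S r e else 0)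
            (fun e he => by
              by_cases h : v ∈ e
              · simpa [h] using hpos e he
              · simp [h]) he
          simpa [hve] using this
        _ = ∑ e ∈ insideEdges G S, ∑ v ∈ good, if v ∈ e then gap hfin S r e else 0 :=
          Finset.sum_comm
        _ ≤ ∑ e ∈ insideEdges G S, 2 * gap hfin S r e := by
          refine Finset.sum_le_sum fun e he => ?_
          rw [← Finset.sum_filter, Finset.sum_const, nsmul_eq_mul]
          refine mul_le_mul_of_nonneg_right ?_ (hpos e he)
          have h2 : (good.filter (· ∈ e)) ⊆ e.toFinset := fun v hv => by
            rw [Sym2.mem_toFinset]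
            exact (Finset.mem_filter.1 hv).2
          have h3 := Finset.card_le_card h2
          have h4 : e.toFinset.card ≤ 2 := by
            induction e with | _ u v =>
            rw [Sym2.toFinset_mk_eq]
            exact Finset.card_le_two
          exact_mod_cast h3.trans h4
        _ = _ := by rw [Finset.mul_sum]
    have h2 := sum_gap_le hconn hfin hS hr
    have h3 : (good.card : ℝ) ≤ 2 / δ * (boundary G S).ncard := by
      rw [div_mul_eq_mul_div, le_div_iff₀ hδ]
      linarith
    have h4 : (S.card : ℝ) ≤ M * ((boundary G S).ncard + good.card) := by exact_mod_cast hM S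
    refine h4.trans ?_
    rw [mul_assoc]
    refine mul_le_mul_of_nonneg_left ?_ (Nat.cast_nonneg _)
    linarith
  obtain ⟨S, hS, hlim⟩ := hamen
  have h1 := hlim.const_mul (M * (1 + 2 / δ) : ℝ)
  rw [mul_zero] at h1
  obtain ⟨n, hn⟩ := (h1.eventually_lt_const one_pos).exists
  have h2 : 0 < ((S n).card : ℝ) := by
    obtain ⟨⟨r, hr⟩⟩ := (hS.connected n).nonempty
    exact_mod_cast Finset.card_pos.2 ⟨r, hr⟩
  rw [← mul_div_assoc, div_lt_one h2] at hn
  exact absurd (key _ (hS.connected n)) (not_le.2 hn)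

theorem tendsto_gap [Infinite V] (hconn : G.Connected) (hfin : ∀ v, (G.neighborSet v).Finite)
    (hamen : IsAmenable G) (hquasi : IsQuasitransitive G) {S : ℕ → Finset V}
    (hS : IsExhaustion G S) {r : ℕ → V} (hr : ∀ n, r n ∈ S n) {e : Sym2 V} (he : e ∈ G.edgeSet) :
    Tendsto (fun n => gap hfin (S n) (r n) e) atTop (𝓝 0) := by
  induction e with | _ a b =>
  have hmem : ∀ {T : Finset V}, a ∈ T → b ∈ T → ∀ v ∈ s(a, b), v ∈ T := by
    intro T ha hb v hv
    rcases Sym2.mem_iff.1 hv with rfl | rfl <;> assumption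
  rw [Metric.tendsto_nhds]
  intro δ hδ
  obtain ⟨T, t, hT, ht, ha, hb, hlt⟩ := exists_gap_lt hconn hfin hamen hquasi he hδ
  filter_upwards [hS.eventually_subset T] with n hn
  rw [Real.dist_0_eq_abs, abs_of_nonneg (gap_nonneg hconn hfin (hS.connected n) (hr n)
    (hmem (hn ha) (hn hb)))]
  exact (gap_anti hconn hfin hT (hS.connected n) hn ht (hr n) (hmem ha hb)).trans_lt hlt

/-- The limit of the wired Green forms. -/
theorem exists_tendsto_wired [Infinite V] (hconn : G.Connected)
    (hfin : ∀ v, (G.neighborSet v).Finite)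
    {e f : Sym2 V} (he : e ∈ G.edgeSet) (hf : f ∈ G.edgeSet) :
    ∃ y, Tendsto (fun D => wired hfin D (incidence e) (incidence f)) atTop (𝓝 y) := by
  have hle : ∀ {e : Sym2 V}, e ∈ G.edgeSet → ∀ D,
      wired hfin D (incidence e) (incidence e) ≤ 1 := by
    intro e he D
    refine (wired_mono hconn hfin (Finset.subset_union_left (s₂ := e.toFinset)) _).trans
      (green_incidence_le_one (nonempty_parents_touchingEdges hconn hfin _) ?_)
    refine mem_touchingEdges.2 ⟨he, (Quot.out e).1, Sym2.out_fst_mem e, ?_⟩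
    simp [Sym2.out_fst_mem e]
  have hlim : ∀ x : V → ℝ, (∃ c, ∀ D, wired hfin D x x ≤ c) →
      ∃ y, Tendsto (fun D => wired hfin D x x) atTop (𝓝 y) := by
    rintro x ⟨c, hc⟩
    exact ⟨_, tendsto_atTop_ciSup (fun D D' h => wired_mono hconn hfin h x)
      ⟨c, Set.forall_mem_range.2 hc⟩⟩
  -- The diagonal entries are monotone and bounded; the others are obtained by polarization.
  obtain ⟨y₁, h₁⟩ := hlim (incidence e + incidence f) ⟨4, fun D => by
    have := green_add_self_le (nonempty_parents_touchingEdges hconn hfin D) (incidence e)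
      (incidence f)
    linarith [hle he D, hle hf D]⟩
  obtain ⟨y₂, h₂⟩ := hlim (incidence e + -incidence f) ⟨4, fun D => by
    have := green_add_self_le (nonempty_parents_touchingEdges hconn hfin D) (incidence e)
      (-incidence f)
    rw [green_neg_left, green_neg_right] at this
    linarith [hle he D, hle hf D]⟩
  refine ⟨(y₁ - y₂) / 4, ((h₁.sub h₂).div_const 4).congr fun D => ?_⟩
  exact (green_polarization _ _).symm

theorem tendsto_interiorVerts (hfin : ∀ v, (G.neighborSet v).Finite) {S : ℕ → Finset V}
    (hS : IsExhaustion G S) : Tendsto (fun n => interiorVerts G (S n)) atTop atTop := by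
  refine tendsto_atTop.2 fun K => ?_
  filter_upwards [hS.eventually_subset (K ∪ K.biUnion fun v => (hfin v).toFinset)] with n hn
  intro v hv
  refine mem_interiorVerts.2 ⟨hn (Finset.mem_union_left _ hv), fun w hw =>
    hn (Finset.mem_union_right _ (Finset.mem_biUnion.2 ⟨v, hv, ?_⟩))⟩
  simpa using hw

theorem tendsto_det_one_sub {n ι : Type*} [Fintype n] [DecidableEq n] {l : Filter ι}
    {F : ι → Matrix n n ℝ}
    {Y : n → n → ℝ} (hF : ∀ i j, Tendsto (fun a => F a i j) l (𝓝 (Y i j))) :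
    Tendsto (fun a => (1 - F a).det) l (𝓝 (1 - Matrix.of Y).det) := by
  have h : Tendsto F l (𝓝 (Matrix.of Y)) :=
    tendsto_pi_nhds.2 fun i => tendsto_pi_nhds.2 fun j => hF i j
  have hc : Continuous fun M : Matrix n n ℝ => (1 - M).det :=
    (continuous_const.sub continuous_id).matrix_det
  exact (hc.tendsto _).comp h

/-- The probabilities that the uniform spanning trees with free and with wired boundary conditions
avoid a finite set of edges have the same limit. -/
theorem exists_limit_avoid [Infinite V] (hconn : G.Connected) (hfin : ∀ v, (G.neighborSet v).Finite)
    (hamen : IsAmenable G) (hquasi : IsQuasitransitive G)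
    (A : Finset (Sym2 V)) (hA : ∀ e ∈ A, e ∈ G.edgeSet) :
    ∃ ℓ : ℝ,
      Tendsto (fun D => ((parents (touchingEdges hfin D \ A) D).card : ℝ) /
        (parents (touchingEdges hfin D) D).card) atTop (𝓝 ℓ) ∧
      ∀ (S : ℕ → Finset V) (r : ℕ → V), IsExhaustion G S → (∀ n, r n ∈ S n) →
        Tendsto (fun n => ((parents (insideEdges G (S n) \ A) ((S n).erase (r n))).card : ℝ) /
          (parents (insideEdges G (S n)) ((S n).erase (r n))).card) atTop (𝓝 ℓ) := by
  have hY : ∀ e f : A, ∃ y, Tendsto (fun D => wired hfin D (incidence e) (incidence f)) atTop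
      (𝓝 y) := fun e f => exists_tendsto_wired hconn hfin (hA e e.2) (hA f f.2)
  choose Y hY using hY
  refine ⟨(1 - Matrix.of Y).det, ?_, ?_⟩
  · refine (tendsto_det_one_sub hY).congr' ?_
    filter_upwards [eventually_ge_atTop (A.biUnion Sym2.toFinset)] with D hD
    have hne := nonempty_parents_touchingEdges hconn hfin D
    have hAD : A ⊆ touchingEdges hfin D := fun e he => mem_touchingEdges.2
      ⟨hA e he, (Quot.out e).1, Sym2.out_fst_mem e, hD (Finset.mem_biUnion.2 ⟨e, he, by
        simp [Sym2.out_fst_mem e]⟩)⟩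
    rw [card_parents_sdiff hne hAD, mul_div_cancel_left₀]
    · rfl
    · exact_mod_cast hne.card_pos.ne'
  · intro S r hS hr
    have hYf : ∀ e f : A, Tendsto (fun n => free G (S n) (r n) (incidence e) (incidence f)) atTop
        (𝓝 (Y e f)) := by
      intro e f
      have h1 := (hY e f).comp (tendsto_interiorVerts hfin hS)
      have h2 : Tendsto (fun n => free G (S n) (r n) (incidence e) (incidence f) -
          wired hfin (interiorVerts G (S n)) (incidence e) (incidence f)) atTop (𝓝 0) := by
        have h3 := ((tendsto_gap hconn hfin hamen hquasi hS hr (hA e e.2)).add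
          (tendsto_gap hconn hfin hamen hquasi hS hr (hA f f.2))).div_const 2
        rw [add_zero, zero_div] at h3
        refine squeeze_zero_norm' ?_ h3
        filter_upwards [hS.eventually_subset (e.1.toFinset ∪ f.1.toFinset)] with n hn
        have hse : ∑ v ∈ S n, incidence (e : Sym2 V) v = 0 := sum_incidence fun v hv =>
          hn (Finset.mem_union_left _ (Sym2.mem_toFinset.2 hv))
        have hsf : ∑ v ∈ S n, incidence (f : Sym2 V) v = 0 := sum_incidence fun v hv =>
          hn (Finset.mem_union_right _ (Sym2.mem_toFinset.2 hv))
        refine abs_green_sub_le (wired_interiorVerts_le hconn hfin (hS.connected n) (hr n) ?_)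
          (wired_interiorVerts_le hconn hfin (hS.connected n) (hr n) ?_)
        · simp [Finset.sum_add_distrib, hse, hsf]
        · simp [Finset.sum_add_distrib, hse, hsf]
      simpa using h2.add h1
    refine (tendsto_det_one_sub hYf).congr' ?_
    filter_upwards [hS.eventually_subset (A.biUnion Sym2.toFinset)] with n hn
    have hne := nonempty_parents_insideEdges (hS.connected n) (hr n)
    have hAD : A ⊆ insideEdges G (S n) := fun e he => mem_insideEdges.2
      ⟨hA e he, fun v hv => hn (Finset.mem_biUnion.2 ⟨e, he, Sym2.mem_toFinset.2 hv⟩)⟩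
    rw [card_parents_sdiff hne hAD, mul_div_cancel_left₀]
    · rfl
    · exact_mod_cast hne.card_pos.ne'

end Amenable

/-! ### Forests given by parent functions -/

/-- The graph in which each vertex `v` with `n v ≠ v` is joined to `n v`. -/
def funGraph {V : Type*} (n : V → V) : SimpleGraph V :=
  SimpleGraph.fromEdgeSet (Set.range fun v => s(v, n v))

/-- The spanning subgraph of `G` whose edges join each vertex of `D` to its image under `p`. -/
def treeConfig {V : Type*} {G : SimpleGraph V} {D : Finset V} (p : D → V) : Config G :=
  fun e => decide (∃ v : D, (e : Sym2 V) = s((v : V), p v))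

section FunGraph

variable {V : Type*} {G : SimpleGraph V} {n : V → V} {D : Finset V}

theorem funGraph_adj {u v : V} : (funGraph n).Adj u v ↔ (n u = v ∨ n v = u) ∧ u ≠ v := by
  simp only [funGraph, SimpleGraph.fromEdgeSet_adj, Set.mem_range, Sym2.eq_iff]
  refine and_congr_left fun _ => ⟨?_, ?_⟩
  · rintro ⟨w, ⟨rfl, h⟩ | ⟨rfl, h⟩⟩
    · exact Or.inl h
    · exact Or.inr h
  · rintro (h | h)
    · exact ⟨u, Or.inl ⟨rfl, h⟩⟩
    · exact ⟨v, Or.inr ⟨rfl, h⟩⟩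

theorem reachable_iterate (u : V) (i : ℕ) : (funGraph n).Reachable u (n^[i] u) := by
  induction i with
  | zero => exact SimpleGraph.Reachable.refl _
  | succ i ih =>
    rw [Function.iterate_succ_apply']
    by_cases h : n^[i] u = n (n^[i] u)
    · rwa [← h]
    · exact ih.trans (SimpleGraph.Adj.reachable (funGraph_adj.2 ⟨Or.inl rfl, h⟩))

theorem funGraph_reachable {u v : V} :
    (funGraph n).Reachable u v ↔ ∃ i j, n^[i] u = n^[j] v := by
  constructor
  · rintro ⟨p⟩
    induction p with
    | nil => exact ⟨0, 0, rfl⟩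
    | @cons u w v h _ ih =>
      obtain ⟨i, j, hij⟩ := ih
      rcases (funGraph_adj.1 h).1 with h | h
      · exact ⟨i + 1, j, by rw [Function.iterate_succ_apply, h, hij]⟩
      · refine ⟨i, j + 1, ?_⟩
        rw [Function.iterate_succ_apply', ← hij, ← Function.iterate_succ_apply' n i w,
          Function.iterate_succ_apply, h]
  · rintro ⟨i, j, h⟩
    exact (reachable_iterate u i).trans (h ▸ (reachable_iterate v j).symm)

theorem exists_iterate_of_update {u : V} :
    ∀ j w, (Function.update n u u)^[j] w = u → ∃ k, n^[k] w = u := by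
  intro j
  induction j with
  | zero => exact fun w hw => ⟨0, hw⟩
  | succ j ih =>
    intro w hw
    by_cases hwu : w = u
    · exact ⟨0, hwu⟩
    · rw [Function.iterate_succ_apply, Function.update_of_ne hwu] at hw
      obtain ⟨k, hk⟩ := ih _ hw
      exact ⟨k + 1, hk⟩

/-- If all periodic points of `n` are fixed points, then `funGraph n` is a forest: each edge
`s(u, n u)` is a bridge, as its removal changes `n` to a map with the fixed point `u`. -/
theorem funGraph_isAcyclic (hn : ∀ v k, n^[k + 1] v = v → n v = v) : (funGraph n).IsAcyclic := by
  have key : ∀ u, u ≠ n u → ¬ ((funGraph n).deleteEdges {s(u, n u)}).Reachable u (n u) := by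
    intro u hu h
    have hle : (funGraph n).deleteEdges {s(u, n u)} ≤ funGraph (Function.update n u u) := by
      intro a b hab
      rw [SimpleGraph.deleteEdges_adj, funGraph_adj, Set.mem_singleton_iff, Sym2.eq_iff] at hab
      rw [funGraph_adj]
      obtain ⟨⟨h1, h2⟩, h3⟩ := hab
      refine ⟨h1.imp (fun hab => ?_) (fun hba => ?_), h2⟩
      · rw [Function.update_of_ne, hab]
        rintro rfl
        exact h3 (Or.inl ⟨rfl, hab.symm⟩)
      · rw [Function.update_of_ne, hba]
        rintro rfl
        exact h3 (Or.inr ⟨hba.symm, rfl⟩)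
    obtain ⟨i, j, hij⟩ := funGraph_reachable.1 (h.mono hle)
    rw [Function.iterate_fixed (Function.update_self _ _ _)] at hij
    obtain ⟨k, hk⟩ := exists_iterate_of_update j _ hij.symm
    exact hu (hn u k hk).symm
  rw [SimpleGraph.isAcyclic_iff_forall_adj_isBridge]
  intro v w hvw
  obtain ⟨rfl | rfl, hne⟩ := funGraph_adj.1 hvw
  · exact SimpleGraph.isBridge_iff.2 (key v hne)
  · rw [SimpleGraph.isBridge_iff, Sym2.eq_swap]
    exact fun h => key w hne.symm h.symm

theorem iterate_step_mul {p : D → V} {v : V} {k : ℕ} (h : (step p)^[k] v = v) (m : ℕ) :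
    (step p)^[k * m] v = v := by
  rw [Function.iterate_mul]
  exact Function.iterate_fixed h m

theorem Leaves.notMem_of_periodic {p : D → V} (hp : Leaves p) {v : V} {k : ℕ}
    (h : (step p)^[k + 1] v = v) : v ∉ D := by
  obtain ⟨m, hm⟩ := hp v
  have := iterate_step_notMem (k := (k + 1) * m) (Nat.le_mul_of_pos_left m k.succ_pos) hm
  rwa [iterate_step_mul h] at this

theorem Leaves.fixed_of_periodic {p : D → V} (hp : Leaves p) {v : V} {k : ℕ}
    (h : (step p)^[k + 1] v = v) : step p v = v := step_of_notMem (hp.notMem_of_periodic h)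

theorem toGraph_adj {ω : Config G} {u v : V} :
    (toGraph ω).Adj u v ↔ ∃ h : s(u, v) ∈ G.edgeSet, ω ⟨s(u, v), h⟩ = true := by
  rw [toGraph, SimpleGraph.fromEdgeSet_adj]
  constructor
  · rintro ⟨⟨h, hω⟩, _⟩
    exact ⟨h, hω⟩
  · rintro ⟨h, hω⟩
    exact ⟨⟨h, hω⟩, G.ne_of_adj h⟩

theorem toGraph_le (ω : Config G) : toGraph ω ≤ G := fun _ _ h => (toGraph_adj.1 h).1

theorem treeConfig_eq_true {p : D → V} {e : G.edgeSet} :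
    treeConfig p e = true ↔ ∃ v : D, (e : Sym2 V) = s((v : V), p v) := decide_eq_true_iff

theorem toGraph_treeConfig {p : D → V} (hp : ∀ v : D, G.Adj v (p v)) :
    toGraph (treeConfig p : Config G) = funGraph (step p) := by
  ext u v
  rw [toGraph_adj, funGraph_adj]
  simp only [treeConfig_eq_true]
  constructor
  · rintro ⟨h, w, hw⟩
    refine ⟨?_, G.ne_of_adj h⟩
    rcases Sym2.eq_iff.1 hw with ⟨rfl, rfl⟩ | ⟨rfl, rfl⟩
    · exact Or.inl (step_of_mem w.2)
    · exact Or.inr (step_of_mem w.2)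
  · rintro ⟨h | h, hne⟩
    · have hu : u ∈ D := by
        by_contra hu
        exact hne (by rwa [step_of_notMem hu] at h)
      rw [step_of_mem hu] at h
      subst h
      exact ⟨hp ⟨u, hu⟩, ⟨u, hu⟩, rfl⟩
    · have hv : v ∈ D := by
        by_contra hv
        exact hne (by rw [step_of_notMem hv] at h; exact h.symm)
      rw [step_of_mem hv] at h
      subst h
      exact ⟨(hp ⟨v, hv⟩).symm, ⟨v, hv⟩, Sym2.eq_swap⟩

/-- The parent function of a tree is unique: at a vertex where two of them differ, the parent for
the first is a child for the second, so they differ there as well. -/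
theorem treeConfig_injOn {p q : D → V} (hp : Leaves p) (hpG : ∀ v : D, G.Adj v (p v))
    (h : (treeConfig p : Config G) = treeConfig q) : p = q := by
  by_contra hne
  obtain ⟨v, hv⟩ := Function.ne_iff.1 hne
  have key : ∀ w : D, p w ≠ q w → ∃ h : p w ∈ D, p ⟨p w, h⟩ ≠ q ⟨p w, h⟩ := by
    intro w hw
    have h1 : (treeConfig q : Config G) ⟨s((w : V), p w), hpG w⟩ = true := by
      rw [← h, treeConfig_eq_true]
      exact ⟨w, rfl⟩
    obtain ⟨u, hu⟩ := treeConfig_eq_true.1 h1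
    rcases Sym2.eq_iff.1 hu with ⟨h2, h3⟩ | ⟨h2, h3⟩
    · exact absurd (h3.trans (congrArg q (Subtype.ext h2.symm))) hw
    · have hD : p w ∈ D := h3 ▸ u.2
      have hu' : u = ⟨p w, hD⟩ := Subtype.ext h3.symm
      refine ⟨hD, fun h4 => ?_⟩
      rw [← hu', ← h2] at h4
      refine hp.notMem_of_periodic (v := (w : V)) (k := 1) ?_ w.2
      rw [Function.iterate_succ_apply, Function.iterate_one, step_of_mem w.2, step_of_mem hD,
        ← hu', h4]
  have hall : ∀ k, ∃ h : (step p)^[k] (v : V) ∈ D, p ⟨_, h⟩ ≠ q ⟨_, h⟩ := by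
    intro k
    induction k with
    | zero => exact ⟨v.2, hv⟩
    | succ k ih =>
      obtain ⟨h1, h2⟩ := ih
      rw [Function.iterate_succ_apply', step_of_mem h1]
      exact key _ h2
  obtain ⟨k, hk⟩ := hp v
  exact hk (hall k).1

/-- The spanning trees of `S` are given by the parent functions towards a root `r`. -/
theorem spanningTrees_eq {S : Finset V} {r : V} (hr : r ∈ S) :
    spanningTrees G S = treeConfig ''
      (↑(parents (insideEdges G S) (S.erase r)) : Set (↥(S.erase r) → V)) := by
  have hconn : ∀ p ∈ parents (insideEdges G S) (S.erase r),
      ((toGraph (treeConfig p : Config G)).induce (S : Set V)).Connected := by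
    intro p hp
    obtain ⟨hpE, hpL⟩ := mem_parents.1 hp
    have hadj : ∀ v : S.erase r, G.Adj v (p v) := fun v => (mem_insideEdges.1 (hpE v)).1
    have hmem : ∀ v : S.erase r, p v ∈ S := fun v =>
      (mem_insideEdges.1 (hpE v)).2 _ (Sym2.mem_mk_right _ _)
    have key : ∀ k v (hv : v ∈ S), depth hpL v = k →
        ((toGraph (treeConfig p : Config G)).induce (S : Set V)).Reachable ⟨v, hv⟩ ⟨r, hr⟩ := by
      intro k
      induction k using Nat.strong_induction_on with
      | _ k ih =>
        rintro v hv rfl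
        by_cases hvr : v = r
        · subst hvr; exact SimpleGraph.Reachable.refl _
        · have hvD : v ∈ S.erase r := Finset.mem_erase.2 ⟨hvr, hv⟩
          refine SimpleGraph.Reachable.trans (SimpleGraph.Adj.reachable ?_)
            (ih _ (depth_lt hpL hvD) (p ⟨v, hvD⟩) (hmem ⟨v, hvD⟩) rfl)
          exact toGraph_adj.2 ⟨hadj ⟨v, hvD⟩, treeConfig_eq_true.2 ⟨⟨v, hvD⟩, rfl⟩⟩
    have : Nonempty (S : Set V) := ⟨⟨r, hr⟩⟩
    exact ⟨fun u v => (key _ u u.2 rfl).trans (key _ v v.2 rfl).symm⟩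
  apply Set.Subset.antisymm
  · -- The parent of a vertex in `T` is a neighbour that is closer to `r`; the tree of these parents
    -- is connected and contained in `T`, and a tree is minimal among the connected graphs.
    rintro T ⟨hT, hTree⟩
    set Γ := (toGraph T).induce (S : Set V) with hΓ
    have hmem : ∀ v : S.erase r, (v : V) ∈ S := fun v => Finset.mem_of_mem_erase v.2
    have h : ∀ v : S.erase r, ∃ w : (S : Set V), Γ.Adj ⟨v, hmem v⟩ w ∧
        Γ.dist w ⟨r, hr⟩ < Γ.dist ⟨v, hmem v⟩ ⟨r, hr⟩ := fun v =>
      exists_adj_dist_lt (hTree.connected _ _)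
        fun h => Finset.ne_of_mem_erase v.2 (congrArg Subtype.val h)
    choose p' hp' hlt using h
    set p : S.erase r → V := fun v => p' v with hp
    have hpar : p ∈ parents (insideEdges G S) (S.erase r) := by
      refine mem_parents.2 ⟨fun v => mem_insideEdges.2 ⟨toGraph_le T (hp' v), ?_⟩,
        leaves_of_lt (fun v => if hv : v ∈ S then Γ.dist ⟨v, hv⟩ ⟨r, hr⟩ else 0) ?_⟩
      · intro w hw
        rcases Sym2.mem_iff.1 hw with rfl | rfl
        · exact hmem v
        · exact (p' v).2
      · intro v
        have h1 : p v ∈ S := (p' v).2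
        simp only [dif_pos (hmem v), dif_pos h1]
        exact hlt v
    have hsub : ∀ e : G.edgeSet, treeConfig p e = true → T e = true := by
      rintro ⟨e, he⟩ h
      obtain ⟨v, rfl⟩ := treeConfig_eq_true.1 h
      exact (toGraph_adj.1 (hp' v)).2
    refine ⟨p, hpar, ?_⟩
    have hle : (toGraph (treeConfig p : Config G)).induce (S : Set V) ≤ Γ := by
      intro u v huv
      obtain ⟨h1, h2⟩ := toGraph_adj.1 huv
      exact toGraph_adj.2 ⟨h1, hsub _ h2⟩
    have hge := (SimpleGraph.isTree_iff_minimal_connected.1 hTree).2 (hconn p hpar) hle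
    funext ⟨e, he⟩
    rw [Bool.eq_iff_iff]
    refine ⟨hsub _, fun hTe => ?_⟩
    have hin := hT _ hTe
    induction e with | _ u v =>
    have hu : u ∈ S := hin u (Sym2.mem_mk_left _ _)
    have hv : v ∈ S := hin v (Sym2.mem_mk_right _ _)
    have h1 : Γ.Adj ⟨u, hu⟩ ⟨v, hv⟩ := toGraph_adj.2 ⟨he, hTe⟩
    exact (toGraph_adj.1 (hge h1)).2
  · rintro _ ⟨p, hp, rfl⟩
    obtain ⟨hpE, hpL⟩ := mem_parents.1 hp
    refine ⟨?_, hconn p hp, ?_⟩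
    · intro e he
      obtain ⟨v, hv⟩ := treeConfig_eq_true.1 he
      intro w hw
      rw [hv] at hw
      exact (mem_insideEdges.1 (hpE v)).2 w hw
    · rw [toGraph_treeConfig fun v => (mem_insideEdges.1 (hpE v)).1]
      exact (funGraph_isAcyclic fun v k => hpL.fixed_of_periodic).induce _

theorem parents_sdiff_eq (E A : Finset (Sym2 V)) :
    parents (E \ A) D = (parents E D).filter fun p => ∀ v : D, s((v : V), p v) ∉ A := by
  ext p
  simp only [Finset.mem_filter, mem_parents, Finset.mem_sdiff]
  constructor
  · exact fun h => ⟨⟨fun v => (h.1 v).1, h.2⟩, fun v => (h.1 v).2⟩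
  · exact fun h => ⟨fun v => ⟨h.1.1 v, h.2 v⟩, h.1.2⟩

theorem treeConfig_avoid {p : D → V} (A : Finset G.edgeSet) :
    (∀ e ∈ A, (treeConfig p : Config G) e = false) ↔
      ∀ v : D, s((v : V), p v) ∉ A.map (Function.Embedding.subtype _) := by
  simp only [← Bool.not_eq_true, treeConfig_eq_true, Finset.mem_map,
    Function.Embedding.subtype_apply, not_exists, not_and]
  constructor
  · rintro h v e he hev
    exact h e he v hev
  · intro h e he v hev
    exact h v e he hev

end FunGraph

/-! ### Forests with one end -/

section OneEnd

variable {V : Type*} {F : SimpleGraph V}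

theorem exists_seq_of_forall {P : V → Prop} {R : V → V → Prop} (h : ∀ v, P v → ∃ w, R v w ∧ P w)
    {v : V} (hv : P v) : ∃ r : ℕ → V, r 0 = v ∧ ∀ n, R (r n) (r (n + 1)) := by
  choose! f hR hP using h
  refine ⟨fun n => f^[n] v, rfl, fun n => ?_⟩
  have hPn : P (f^[n] v) := by
    induction n with
    | zero => exact hv
    | succ n ih => rw [Function.iterate_succ_apply']; exact hP _ ih
  simp only [Function.iterate_succ_apply']
  exact hR _ hPn

/-- Kőnig's lemma: an infinite component of a locally finite graph contains a ray from each of its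
vertices.  The ray follows vertices that lie on geodesics from `v` to infinitely many vertices. -/
theorem exists_ray (hloc : ∀ v, (F.neighborSet v).Finite) {v : V}
    (hinf : {w | F.Reachable v w}.Infinite) : ∃ r, IsRay F r ∧ r 0 = v := by
  set I : V → Set V := fun u => {w | F.Reachable v w ∧ F.dist v w = F.dist v u + F.dist u w}
    with hI
  have hstep : ∀ u, F.Reachable v u ∧ (I u).Infinite → ∃ w,
      (F.Adj u w ∧ F.dist v w = F.dist v u + 1) ∧ F.Reachable v w ∧ (I w).Infinite := by
    rintro u ⟨hvu, hu⟩
    by_contra! hcon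
    refine hu (((((hloc u).subset fun w (hw : w ∈ {w | F.Adj u w ∧ F.dist v w = F.dist v u + 1}) =>
      hw.1).biUnion (t := I) fun w hw => ?_).insert u).subset ?_)
    · exact hcon w hw (hvu.trans hw.1.reachable)
    · rintro w ⟨hvw, hw⟩
      by_cases huw : u = w
      · exact Or.inl huw.symm
      · have huwr : F.Reachable u w := hvu.symm.trans hvw
        obtain ⟨x, hux, hx⟩ := exists_adj_dist_lt huwr huw
        have h1 : F.dist v x ≤ F.dist v u + F.dist u x := hvu.dist_triangle_left x
        have h2 : F.dist v w ≤ F.dist v x + F.dist x w :=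
          (hvu.trans hux.reachable).dist_triangle_left w
        have h3 : F.dist u x = 1 := SimpleGraph.dist_eq_one_iff_adj.2 hux
        refine Or.inr (Set.mem_biUnion (x := x) ⟨hux, by omega⟩ ⟨hvw, by omega⟩)
  obtain ⟨r, hr0, hr⟩ := exists_seq_of_forall hstep
    ⟨SimpleGraph.Reachable.refl _, by simpa [hI] using hinf⟩
  refine ⟨r, ⟨?_, fun n => (hr n).1⟩, hr0⟩
  have hdist : ∀ n, F.dist v (r n) = n := by
    intro n
    induction n with
    | zero => simp [hr0]
    | succ n ih => rw [(hr n).2, ih]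
  intro m n hmn
  rw [← hdist m, ← hdist n, hmn]

theorem IsRay.reachable {r : ℕ → V} (hr : IsRay F r) (n : ℕ) : F.Reachable (r 0) (r n) := by
  induction n with
  | zero => exact SimpleGraph.Reachable.refl _
  | succ n ih => exact ih.trans (hr.2 n).reachable

theorem IsRay.tail {r : ℕ → V} (hr : IsRay F r) (n : ℕ) : IsRay F fun i => r (n + i) :=
  ⟨fun _ _ h => Nat.add_left_cancel (hr.1 h), fun i => hr.2 (n + i)⟩

theorem IsRay.exists_eq_of_numEnds {r r' : ℕ → V} (hr : IsRay F r) (hr' : IsRay F r')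
    (h : F.Reachable (r 0) (r' 0)) (hend : numEnds F (F.connectedComponentMk (r 0)) = 1) :
    ∃ i j, r i = r' j := by
  by_contra! hne
  have hrr : r ≠ r' := fun h => hne 0 0 (congrFun h 0)
  have h2 : (2 : ℕ∞) ≤ numEnds F (F.connectedComponentMk (r 0)) := by
    rw [← Set.encard_pair hrr, numEnds]
    refine le_iSup₂ (f := fun (R : Set (ℕ → V)) (_ : (∀ s ∈ R, IsRay F s ∧ Set.range s ⊆
      (F.connectedComponentMk (r 0)).supp) ∧ R.PairwiseDisjoint Set.range) => R.encard)
      {r, r'} ⟨?_, ?_⟩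
    · rintro s (rfl | rfl)
      · refine ⟨hr, ?_⟩
        rintro _ ⟨n, rfl⟩
        exact SimpleGraph.ConnectedComponent.eq.2 (hr.reachable n).symm
      · refine ⟨hr', ?_⟩
        rintro _ ⟨n, rfl⟩
        exact SimpleGraph.ConnectedComponent.eq.2 (h.trans (hr'.reachable n)).symm
    · have hd : Disjoint (Set.range r) (Set.range r') := by
        rw [Set.disjoint_left]
        rintro _ ⟨i, rfl⟩ ⟨j, hj⟩
        exact hne i j hj.symm
      rintro s (rfl | rfl) t (rfl | rfl) hst
      · exact absurd rfl hst
      · exact hd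
      · exact hd.symm
      · exact absurd rfl hst
  rw [hend] at h2
  exact absurd h2 (by decide)

theorem IsRay.exists_path {r : ℕ → V} (hr : IsRay F r) (k : ℕ) :
    ∀ {n : ℕ} {x y : V}, x = r n → y = r (n + k) → ∃ p : F.Walk x y, p.IsPath ∧
      (∀ z ∈ p.support, ∃ i, n ≤ i ∧ z = r i) ∧ (0 < k → p.snd = r (n + 1)) := by
  induction k with
  | zero =>
    rintro n x y rfl rfl
    exact ⟨.nil, SimpleGraph.Walk.IsPath.nil, fun z hz => ⟨n, le_rfl, by simpa using hz⟩,
      fun h => absurd h (lt_irrefl 0)⟩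
  | succ k ih =>
    rintro n x y rfl rfl
    obtain ⟨p, hp, hsupp, -⟩ := ih (n := n + 1) (y := r (n + (k + 1))) rfl
      (by rw [add_right_comm, add_assoc])
    refine ⟨.cons (hr.2 n) p, ?_, ?_, fun _ => SimpleGraph.Walk.snd_cons _ _⟩
    · rw [SimpleGraph.Walk.cons_isPath_iff]
      refine ⟨hp, fun h => ?_⟩
      obtain ⟨i, hi, h⟩ := hsupp _ h
      have := hr.1 h
      omega
    · intro z hz
      rw [SimpleGraph.Walk.support_cons, List.mem_cons] at hz
      rcases hz with rfl | hz
      · exact ⟨n, le_rfl, rfl⟩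
      · obtain ⟨i, hi, rfl⟩ := hsupp z hz
        exact ⟨i, by omega, rfl⟩

/-- In a forest with one end in each component, the ray from a vertex is unique: after the first
vertex where two rays differ they would be disjoint. -/
theorem IsRay.eq_of_numEnds (hac : F.IsAcyclic) (hend : ∀ c, numEnds F c = 1) {r r' : ℕ → V}
    (hr : IsRay F r) (hr' : IsRay F r') (h : r 0 = r' 0) : r = r' := by
  by_contra hne
  have hex : ∃ m, r m ≠ r' m := Function.ne_iff.1 hne
  obtain ⟨n, hn⟩ : ∃ n, Nat.find hex = n + 1 := Nat.exists_eq_succ_of_ne_zero fun h0 =>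
    Nat.find_spec hex (by rw [h0, h])
  have h1 : r (n + 1) ≠ r' (n + 1) := hn ▸ Nat.find_spec hex
  have h2 : r n = r' n := by
    by_contra h2
    have := Nat.find_min' hex h2
    omega
  have h3 : F.Reachable (r (n + 1 + 0)) (r' (n + 1 + 0)) :=
    (hr.reachable _).symm.trans (h ▸ hr'.reachable _)
  obtain ⟨i, j, hij⟩ := (hr.tail (n + 1)).exists_eq_of_numEnds (hr'.tail (n + 1)) h3 (hend _)
  obtain ⟨p, hp, -, hps⟩ := hr.exists_path (i + 1) (n := n) (y := r (n + 1 + i)) rfl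
    (by rw [add_right_comm, add_assoc])
  obtain ⟨q, hq, -, hqs⟩ := hr'.exists_path (j + 1) (n := n) (y := r (n + 1 + i)) h2
    (hij.trans (by rw [add_right_comm, add_assoc]))
  have h4 : p = q := congrArg Subtype.val ((hac.subsingleton_path _ _).elim ⟨p, hp⟩ ⟨q, hq⟩)
  rw [← hps i.succ_pos, ← hqs j.succ_pos, h4] at h1
  exact h1 rfl

/-- A locally finite forest with infinite components, each with one end, is given by the function
that sends each vertex to the next one in the direction of the end; each vertex has finitely many
descendants. -/
theorem exists_next (hloc : ∀ v, (F.neighborSet v).Finite) (hac : F.IsAcyclic)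
    (hinf : ∀ c : F.ConnectedComponent, c.supp.Infinite) (hend : ∀ c, numEnds F c = 1) :
    ∃ n : V → V, F = funGraph n ∧ (∀ v k, n^[k + 1] v ≠ v) ∧
      ∀ v, {u | ∃ k, n^[k] u = v}.Finite := by
  have hray : ∀ v, ∃ r, IsRay F r ∧ r 0 = v := fun v => exists_ray hloc (by
    refine (hinf (F.connectedComponentMk v)).mono fun w hw => ?_
    exact (SimpleGraph.ConnectedComponent.eq.1 hw).symm)
  choose ρ hρ hρ0 using hray
  have huniq : ∀ {r : ℕ → V} {v : V}, IsRay F r → r 0 = v → r = ρ v := fun hr hr0 =>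
    hr.eq_of_numEnds hac hend (hρ _) (hr0.trans (hρ0 _).symm)
  set n : V → V := fun v => ρ v 1 with hn
  have hadj : ∀ v, F.Adj v (n v) := fun v => by
    have := (hρ v).2 0
    rwa [hρ0] at this
  have hiter : ∀ i v, n^[i] v = ρ v i := by
    intro i
    induction i with
    | zero => exact fun v => (hρ0 v).symm
    | succ i ih =>
      intro v
      rw [Function.iterate_succ_apply, ih, ← huniq (v := n v) ((hρ v).tail 1) rfl, add_comm]
  have hper : ∀ v k, n^[k + 1] v ≠ v := by
    intro v k h
    rw [hiter] at h
    have := (hρ v).1 (h.trans (hρ0 v).symm)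
    omega
  refine ⟨n, ?_, hper, fun v => ?_⟩
  · ext u v
    rw [funGraph_adj]
    constructor
    · intro huv
      refine ⟨?_, huv.ne⟩
      -- If `v` is on the ray from `u`, it is its first vertex, as paths in a forest are unique.
      -- Otherwise the ray from `u`, preceded by `v`, is the ray from `v`.
      by_cases hv : ∃ k, ρ u k = v
      · obtain ⟨k, rfl⟩ := hv
        left
        obtain ⟨p, hp, -, hps⟩ := (hρ u).exists_path k (n := 0) (x := u) (y := ρ u k)
          (hρ0 u).symm (by rw [zero_add])
        have hk : 0 < k := Nat.pos_of_ne_zero fun h => huv.ne (by rw [h, hρ0])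
        have h1 := congrArg Subtype.val ((hac.subsingleton_path _ _).elim ⟨p, hp⟩
          (SimpleGraph.Path.singleton huv))
        have h2 : p.snd = ρ u k := by
          rw [show p = _ from h1]
          rfl
        rw [← h2, hps hk]
      · right
        push Not at hv
        have h1 : IsRay F (fun i => Nat.casesOn i v (ρ u) : ℕ → V) := by
          constructor
          · rintro (_ | i) (_ | j) h
            · rfl
            · exact absurd h.symm (hv j)
            · exact absurd h (hv i)
            · exact congrArg _ ((hρ u).1 h)
          · rintro (_ | i)
            · change F.Adj v (ρ u 0)
              rw [hρ0]
              exact huv.symm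
            · exact (hρ u).2 i
        have h2 := huniq (v := v) h1 rfl
        change ρ v 1 = u
        rw [← h2]
        exact hρ0 u
    · rintro ⟨rfl | rfl, -⟩
      · exact hadj u
      · exact (hadj v).symm
  · -- If `v` had infinitely many descendants, there would be a ray of descendants, which would have
    -- to meet the ray from `n v`, so that the orbit of `v` would return to `v`.
    by_contra hv
    have hstep : ∀ u, {w | ∃ k, n^[k] w = u}.Infinite →
        ∃ w, n w = u ∧ {x | ∃ k, n^[k] x = w}.Infinite := by
      intro u hu
      by_contra! hcon
      refine hu (((((hloc u).subset fun w (hw : n w = u) => by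
        have := hadj w
        rw [hw] at this
        exact this.symm).biUnion (t := fun w => {x | ∃ k, n^[k] x = w}) fun w hw =>
          hcon w hw).insert u).subset ?_)
      rintro x ⟨k, hk⟩
      cases k with
      | zero => exact Or.inl hk
      | succ k =>
        refine Or.inr (Set.mem_biUnion (x := n^[k] x) ?_ ⟨k, rfl⟩)
        rw [Function.iterate_succ_apply'] at hk
        exact hk
    obtain ⟨r, hr0, hr⟩ := exists_seq_of_forall hstep hv
    have hback : ∀ k i, n^[k] (r (i + k)) = r i := by
      intro k
      induction k with
      | zero => exact fun i => rfl
      | succ k ih =>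
        intro i
        rw [Function.iterate_succ_apply, ← add_assoc, hr, ih]
    have hrr : IsRay F r := by
      refine ⟨?_, fun i => ?_⟩
      · intro i j hij
        by_contra hne
        wlog hlt : i < j generalizing i j
        · exact this hij.symm (Ne.symm hne) (by omega)
        obtain ⟨k, rfl⟩ := Nat.exists_eq_add_of_lt hlt
        refine hper (r i) k ?_
        conv_lhs => rw [hij]
        exact hback (k + 1) i
      · have := hadj (r (i + 1))
        rw [hr] at this
        exact this.symm
    obtain ⟨i, j, hij⟩ := hrr.exists_eq_of_numEnds (hρ (n v))
      (by rw [hr0, hρ0]; exact (hadj v).reachable) (hend _)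
    have h1 := hback i 0
    rw [zero_add, hij, ← hiter, ← Function.iterate_succ_apply, ← Function.iterate_add_apply,
      hr0] at h1
    exact hper v (i + j) h1

end OneEnd

/-! ### Replacing the part of a forest that touches a finite set -/

/-- The edges of `G` without an endpoint in `D`. -/
def untouched {V : Type*} (G : SimpleGraph V) (D : Finset V) : Set G.edgeSet :=
  {e | ∀ v ∈ (e : Sym2 V), v ∉ D}

/-- The configurations whose restriction to the complement of `D` has infinite components. -/
def escape {V : Type*} (G : SimpleGraph V) (D : Finset V) : Set (Config G) :=
  {ω | ∀ v ∉ D, {w | (toGraph (restrictTo (untouched G D) ω)).Reachable v w}.Infinite}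

/-- `ω` is the forest that joins each vertex `v` to `n v`, its orbits under `n` are infinite, and
each vertex has finitely many descendants: `n v` is the next vertex in the direction of the only
end of the component of `v`. -/
def IsEndMap {V : Type*} {G : SimpleGraph V} (ω : Config G) (n : V → V) : Prop :=
  toGraph ω = funGraph n ∧ (∀ v k, n^[k + 1] v ≠ v) ∧ ∀ v, {u | ∃ k, n^[k] u = v}.Finite

/-- The configuration that agrees with `ω` away from `D` and with the tree of `p` on the edges that
touch `D`. -/
def glue {V : Type*} {G : SimpleGraph V} {D : Finset V} (p : D → V) (ω : Config G) : Config G :=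
  fun e => if e ∈ untouched G D then ω e else treeConfig p e

/-- The map `m`, stopped before it leaves `S`. -/
def cut {V : Type*} (S : Finset V) (m : V → V) (v : V) : V := if v ∈ S ∧ m v ∈ S then m v else v

/-- `D` with its neighbours. -/
def closedNbhd {V : Type*} {G : SimpleGraph V} (hfin : ∀ v, (G.neighborSet v).Finite)
    (D : Finset V) : Finset V := D ∪ D.biUnion fun v => (hfin v).toFinset

section Glue

variable {V : Type*} {G : SimpleGraph V} {n m : V → V} {D S : Finset V} {ω : Config G}

theorem restrictTo_apply_of_mem {X : Set G.edgeSet} {e : G.edgeSet} (h : e ∈ X) :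
    restrictTo X ω e = ω e := if_pos h

theorem restrictTo_apply_of_notMem {X : Set G.edgeSet} {e : G.edgeSet} (h : e ∉ X) :
    restrictTo X ω e = false := if_neg h

theorem restrictTo_restrictTo {X Y : Set G.edgeSet} (h : X ⊆ Y) :
    restrictTo X (restrictTo Y ω) = restrictTo X ω := by
  funext e
  by_cases he : e ∈ X
  · rw [restrictTo_apply_of_mem he, restrictTo_apply_of_mem he, restrictTo_apply_of_mem (h he)]
  · rw [restrictTo_apply_of_notMem he, restrictTo_apply_of_notMem he]

theorem restrictTo_adj {X : Set G.edgeSet} {u v : V} :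
    (toGraph (restrictTo X ω)).Adj u v ↔
      (toGraph ω).Adj u v ∧ ∃ h : s(u, v) ∈ G.edgeSet, (⟨s(u, v), h⟩ : G.edgeSet) ∈ X := by
  rw [toGraph_adj]
  constructor
  · rintro ⟨h, hω⟩
    by_cases hX : (⟨s(u, v), h⟩ : G.edgeSet) ∈ X
    · rw [restrictTo_apply_of_mem hX] at hω
      exact ⟨toGraph_adj.2 ⟨h, hω⟩, h, hX⟩
    · rw [restrictTo_apply_of_notMem hX] at hω
      exact absurd hω (by simp)
  · rintro ⟨h, _, hX⟩
    obtain ⟨h1, h2⟩ := toGraph_adj.1 h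
    exact ⟨h1, by rwa [restrictTo_apply_of_mem hX]⟩

theorem mk_mem_untouched {u v : V} {h : s(u, v) ∈ G.edgeSet} :
    (⟨s(u, v), h⟩ : G.edgeSet) ∈ untouched G D ↔ u ∉ D ∧ v ∉ D := by
  simp [untouched]

theorem mk_mem_inside {u v : V} {h : s(u, v) ∈ G.edgeSet} :
    (⟨s(u, v), h⟩ : G.edgeSet) ∈ inside G S ↔ u ∈ S ∧ v ∈ S := by
  simp [inside]

theorem restrictTo_untouched_adj {u v : V} :
    (toGraph (restrictTo (untouched G D) ω)).Adj u v ↔ (toGraph ω).Adj u v ∧ u ∉ D ∧ v ∉ D := by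
  rw [restrictTo_adj]
  simp only [mk_mem_untouched]
  exact and_congr_right fun h => ⟨fun h' => h'.2, fun h' => ⟨toGraph_le ω h, h'⟩⟩

theorem restrictTo_inside_adj {u v : V} :
    (toGraph (restrictTo (inside G S) ω)).Adj u v ↔ (toGraph ω).Adj u v ∧ u ∈ S ∧ v ∈ S := by
  rw [restrictTo_adj]
  simp only [mk_mem_inside]
  exact and_congr_right fun h => ⟨fun h' => h'.2, fun h' => ⟨toGraph_le ω h, h'⟩⟩

theorem untouched_anti {D D' : Finset V} (h : D ⊆ D') : untouched G D' ⊆ untouched G D :=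
  fun _ he v hv hD => he v hv (h hD)

theorem mem_escape_iff_restrictTo {D' : Finset V} (h : D ⊆ D') :
    restrictTo (untouched G D) ω ∈ escape G D' ↔ ω ∈ escape G D' := by
  simp only [escape, Set.mem_ofPred_eq, restrictTo_restrictTo (untouched_anti h)]

theorem IsEndMap.ne (h : IsEndMap ω n) (v : V) : n v ≠ v := h.2.1 v 0

theorem IsEndMap.adj (h : IsEndMap ω n) (v : V) : (toGraph ω).Adj v (n v) := by
  rw [h.1, funGraph_adj]
  exact ⟨Or.inl rfl, (h.ne v).symm⟩

theorem iterate_injective_of_not_periodic (hn : ∀ v k, n^[k + 1] v ≠ v) (v : V) :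
    Function.Injective fun i => n^[i] v := by
  intro i j hij
  by_contra hne
  wlog hlt : i < j generalizing i j
  · exact this hij.symm (Ne.symm hne) (by omega)
  obtain ⟨k, rfl⟩ := Nat.exists_eq_add_of_lt hlt
  refine hn (n^[i] v) k ?_
  rw [← Function.iterate_add_apply, add_comm (k + 1), ← add_assoc]
  exact hij.symm

/-- The restriction of a one-ended forest to the complement of `D` has infinite components if and
only if no path towards the end enters `D`. -/
theorem IsEndMap.mem_escape_iff (h : IsEndMap ω n) : ω ∈ escape G D ↔ ∀ v ∉ D, n v ∉ D := by
  constructor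
  · intro hesc v hv hnv
    refine hesc v hv ((h.2.2 v).subset fun w hw => ?_)
    have hle : toGraph (restrictTo (untouched G D) ω) ≤ funGraph (Function.update n v v) := by
      intro a b hab
      obtain ⟨h1, h2⟩ := restrictTo_untouched_adj.1 hab
      rw [h.1, funGraph_adj] at h1
      rw [funGraph_adj]
      refine ⟨h1.1.imp (fun hab => ?_) (fun hba => ?_), h1.2⟩
      · rwa [Function.update_of_ne]
        rintro rfl
        exact h2.2 (hab ▸ hnv)
      · rwa [Function.update_of_ne]
        rintro rfl
        exact h2.1 (hba ▸ hnv)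
    obtain ⟨i, j, hij⟩ := funGraph_reachable.1 (hw.mono hle)
    rw [Function.iterate_fixed (Function.update_self _ _ _)] at hij
    exact exists_iterate_of_update j w hij.symm
  · intro hn v hv
    have hoff : ∀ i, n^[i] v ∉ D := by
      intro i
      induction i with
      | zero => exact hv
      | succ i ih => rw [Function.iterate_succ_apply']; exact hn _ ih
    refine (Set.infinite_range_of_injective
      (iterate_injective_of_not_periodic h.2.1 v)).mono ?_
    rintro _ ⟨i, rfl⟩
    induction i with
    | zero => exact SimpleGraph.Reachable.refl _
    | succ i ih =>
      refine SimpleGraph.Reachable.trans ih (SimpleGraph.Adj.reachable ?_)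
      simp only [Function.iterate_succ_apply']
      exact restrictTo_untouched_adj.2 ⟨h.adj _, hoff i, hn _ (hoff i)⟩

theorem IsEndMap.union_mem_escape {D' : Finset V} (h : IsEndMap ω n) (h1 : ω ∈ escape G D)
    (h2 : ω ∈ escape G D') : ω ∈ escape G (D ∪ D') := by
  rw [h.mem_escape_iff] at *
  intro v hv
  rw [Finset.notMem_union] at *
  exact ⟨h1 v hv.1, h2 v hv.2⟩

/-- The descendants of a finite set form a finite set that no path towards the end enters. -/
theorem IsEndMap.exists_mem_escape (h : IsEndMap ω n) (K : Finset V) :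
    ∃ D, K ⊆ D ∧ ω ∈ escape G D := by
  refine ⟨K.biUnion fun v => (h.2.2 v).toFinset, fun v hv => Finset.mem_biUnion.2 ⟨v, hv, by
    simpa using ⟨0, rfl⟩⟩, h.mem_escape_iff.2 fun v hv hnv => hv ?_⟩
  simp only [Finset.mem_biUnion, Set.Finite.mem_toFinset, Set.mem_ofPred_eq] at hnv ⊢
  obtain ⟨u, hu, k, hk⟩ := hnv
  exact ⟨u, hu, k + 1, hk⟩

/-- If no path towards the end enters `D`, then the edges that touch `D` form a tree when the
complement of `D` is contracted. -/
theorem IsEndMap.exists_parents (hfin : ∀ v, (G.neighborSet v).Finite) (h : IsEndMap ω n)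
    (hn : ∀ v ∉ D, n v ∉ D) : ∃ p ∈ parents (touchingEdges hfin D) D,
      restrictTo (untouched G D)ᶜ ω = treeConfig p := by
  refine ⟨fun v => n v, mem_parents.2 ⟨fun v => mem_touchingEdges.2 ⟨toGraph_le ω (h.adj v), v,
    Sym2.mem_mk_left _ _, v.2⟩, fun v => ?_⟩, ?_⟩
  · by_contra! hv
    have hiter : ∀ k, (step fun v : D => n v)^[k] v = n^[k] v := by
      intro k
      induction k with
      | zero => rfl
      | succ k ih =>
        rw [Function.iterate_succ_apply', step_of_mem (hv k), Function.iterate_succ_apply', ← ih]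
    refine Set.infinite_range_of_injective (iterate_injective_of_not_periodic h.2.1 v)
      (D.finite_toSet.subset ?_)
    rintro _ ⟨k, rfl⟩
    have := hv k
    rwa [hiter] at this
  · funext ⟨e, he⟩
    rw [Bool.eq_iff_iff, treeConfig_eq_true]
    by_cases hD : (⟨e, he⟩ : G.edgeSet) ∈ untouched G D
    · rw [restrictTo_apply_of_notMem (by simpa using hD)]
      simp only [Bool.false_eq_true, false_iff, not_exists]
      rintro v rfl
      exact hD v (Sym2.mem_mk_left _ _) v.2
    · rw [restrictTo_apply_of_mem hD]
      constructor
      · intro hω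
        induction e with | _ u v =>
        have h1 : (toGraph ω).Adj u v := toGraph_adj.2 ⟨he, hω⟩
        rw [mk_mem_untouched] at hD
        rw [h.1, funGraph_adj] at h1
        rcases h1.1 with rfl | rfl
        · have hu : u ∈ D := by
            by_contra hu
            exact hD ⟨hu, hn u hu⟩
          exact ⟨⟨u, hu⟩, rfl⟩
        · have hv : v ∈ D := by
            by_contra hv
            exact hD ⟨hn v hv, hv⟩
          exact ⟨⟨v, hv⟩, Sym2.eq_swap⟩
      · rintro ⟨v, rfl⟩
        exact (toGraph_adj.1 (h.adj v)).2

theorem toGraph_glue {p : D → V} (hpG : ∀ v : D, G.Adj v (p v)) (h : IsEndMap ω n)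
    (hn : ∀ v ∉ D, n v ∉ D) :
    toGraph (glue p ω) = funGraph fun v => if hv : v ∈ D then p ⟨v, hv⟩ else n v := by
  have hleft : ∀ u v, (if hv : u ∈ D then p ⟨u, hv⟩ else n u) = v → u ≠ v →
      (toGraph (glue p ω)).Adj u v := by
    rintro u v rfl huv
    by_cases hu : u ∈ D
    · simp only [dif_pos hu]
      refine toGraph_adj.2 ⟨hpG ⟨u, hu⟩, ?_⟩
      rw [glue, if_neg fun h => h u (Sym2.mem_mk_left _ _) hu]
      exact treeConfig_eq_true.2 ⟨⟨u, hu⟩, rfl⟩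
    · simp only [dif_neg hu]
      obtain ⟨h1, h2⟩ := toGraph_adj.1 (h.adj u)
      refine toGraph_adj.2 ⟨h1, ?_⟩
      rwa [glue, if_pos (mk_mem_untouched.2 ⟨hu, hn u hu⟩)]
  ext u v
  rw [funGraph_adj]
  constructor
  · intro huv
    refine ⟨?_, huv.ne⟩
    obtain ⟨h1, h2⟩ := toGraph_adj.1 huv
    rw [glue] at h2
    split_ifs at h2 with hD
    · rw [mk_mem_untouched] at hD
      rw [dif_neg hD.1, dif_neg hD.2]
      have : (toGraph ω).Adj u v := toGraph_adj.2 ⟨h1, h2⟩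
      rw [h.1, funGraph_adj] at this
      exact this.1
    · obtain ⟨w, hw⟩ := treeConfig_eq_true.1 h2
      rcases Sym2.eq_iff.1 hw with ⟨rfl, rfl⟩ | ⟨rfl, rfl⟩
      · left; rw [dif_pos w.2]
      · right; rw [dif_pos w.2]
  · rintro ⟨h1 | h1, h2⟩
    · exact hleft u v h1 h2
    · exact (hleft v u h1 h2.symm).symm

theorem glue_not_periodic {p : D → V} (hp : Leaves p) (hper : ∀ v k, n^[k + 1] v ≠ v)
    (hn : ∀ v ∉ D, n v ∉ D) (v : V) (k : ℕ) :
    (fun v => if hv : v ∈ D then p ⟨v, hv⟩ else n v)^[k + 1] v ≠ v := by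
  set m : V → V := fun v => if hv : v ∈ D then p ⟨v, hv⟩ else n v with hm
  have hoff : ∀ i w, w ∉ D → m^[i] w = n^[i] w ∧ m^[i] w ∉ D := by
    intro i w hw
    induction i with
    | zero => exact ⟨rfl, hw⟩
    | succ i ih =>
      rw [Function.iterate_succ_apply', Function.iterate_succ_apply', ← ih.1]
      have : m (m^[i] w) = n (m^[i] w) := dif_neg ih.2
      rw [this]
      exact ⟨rfl, hn _ ih.2⟩
  intro h
  by_cases hv : v ∈ D
  · have hex : ∃ j, m^[j] v ∉ D := by
      by_contra! hcon
      obtain ⟨k, hk⟩ := hp v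
      have hiter : ∀ j, (step p)^[j] v = m^[j] v := by
        intro j
        induction j with
        | zero => rfl
        | succ j ih =>
          rw [Function.iterate_succ_apply', Function.iterate_succ_apply', ih, step_of_mem (hcon j)]
          have : m (m^[j] v) = p ⟨_, hcon j⟩ := dif_pos (hcon j)
          exact this.symm
      rw [hiter] at hk
      exact hk (hcon k)
    obtain ⟨j, hj⟩ := hex
    have h1 : m^[(k + 1) * j] v = v := by
      rw [Function.iterate_mul]
      exact Function.iterate_fixed h j
    have h2 := (hoff ((k + 1) * j - j) _ hj).2
    rw [← Function.iterate_add_apply, Nat.sub_add_cancel (Nat.le_mul_of_pos_left j k.succ_pos),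
      h1] at h2
    exact h2 hv
  · rw [(hoff (k + 1) v hv).1] at h
    exact hper v k h

theorem toGraph_restrictTo_inside (h : toGraph ω = funGraph m) :
    toGraph (restrictTo (inside G S) ω) = funGraph (cut S m) := by
  ext u v
  rw [restrictTo_inside_adj, funGraph_adj, h, funGraph_adj]
  simp only [cut]
  constructor
  · rintro ⟨⟨rfl | rfl, h1⟩, h2, h3⟩
    · exact ⟨Or.inl (if_pos ⟨h2, h3⟩), h1⟩
    · exact ⟨Or.inr (if_pos ⟨h3, h2⟩), h1⟩
  · rintro ⟨h1 | h1, hne⟩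
    · split_ifs at h1 with h2
      · subst h1; exact ⟨⟨Or.inl rfl, hne⟩, h2⟩
      · exact absurd h1 hne
    · split_ifs at h1 with h2
      · subst h1; exact ⟨⟨Or.inr rfl, hne⟩, h2.2, h2.1⟩
      · exact absurd h1 hne.symm

theorem cut_fixed_of_periodic (hm : ∀ v k, m^[k + 1] v ≠ v) {v : V} {k : ℕ}
    (h : (cut S m)^[k + 1] v = v) : cut S m v = v := by
  have key : ∀ k, (cut S m)^[k] v = m^[k] v ∨ cut S m ((cut S m)^[k] v) = (cut S m)^[k] v := by
    intro k
    induction k with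
    | zero => exact Or.inl rfl
    | succ k ih =>
      rw [Function.iterate_succ_apply']
      rcases ih with h1 | h1
      · by_cases h2 : m^[k] v ∈ S ∧ m (m^[k] v) ∈ S
        · left
          rw [h1, Function.iterate_succ_apply', cut, if_pos h2]
        · right
          have : cut S m ((cut S m)^[k] v) = (cut S m)^[k] v := by rw [h1, cut, if_neg h2]
          rw [this, this]
      · right
        rw [h1, h1]
  rcases key (k + 1) with h1 | h1
  · exact absurd (h1.symm.trans h) (hm v k)
  · rwa [h] at h1

/-- The restriction to `S` of a forest with infinite orbits touches the boundary with each
component. -/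
theorem isBoundaryForest_restrictTo (h : toGraph ω = funGraph m) (hm : ∀ v k, m^[k + 1] v ≠ v) :
    IsBoundaryForest S (restrictTo (inside G S) ω) := by
  refine ⟨fun e he => ?_, ?_, fun v hv => ?_⟩
  · by_contra hS
    rw [restrictTo_apply_of_notMem hS] at he
    exact absurd he (by simp)
  · rw [toGraph_restrictTo_inside h]
    exact funGraph_isAcyclic fun v k => cut_fixed_of_periodic hm
  · have hex : ∃ i, m^[i] v ∉ S := by
      by_contra! hcon
      refine Set.infinite_range_of_injective (iterate_injective_of_not_periodic hm v)
        (S.finite_toSet.subset ?_)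
      rintro _ ⟨i, rfl⟩
      exact hcon i
    obtain ⟨i, hi⟩ : ∃ i, Nat.find hex = i + 1 := Nat.exists_eq_succ_of_ne_zero fun h0 => by
      have := Nat.find_spec hex
      rw [h0] at this
      exact this hv
    have hlt : ∀ j ≤ i, m^[j] v ∈ S := fun j hj => by
      by_contra hj'
      have := Nat.find_min' hex hj'
      omega
    have hout : m (m^[i] v) ∉ S := by
      have := Nat.find_spec hex
      rwa [hi, Function.iterate_succ_apply'] at this
    have hiter : ∀ j ≤ i, (cut S m)^[j] v = m^[j] v := by
      intro j
      induction j with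
      | zero => exact fun _ => rfl
      | succ j ih =>
        intro hj
        have h1 := hlt (j + 1) hj
        rw [Function.iterate_succ_apply'] at h1
        rw [Function.iterate_succ_apply', Function.iterate_succ_apply', ih (by omega), cut,
          if_pos ⟨hlt j (by omega), h1⟩]
    refine ⟨m^[i] v, ⟨hlt i le_rfl, m (m^[i] v), hout, ?_⟩, ?_⟩
    · refine toGraph_le ω ?_
      rw [h, funGraph_adj]
      exact ⟨Or.inl rfl, (hm _ 0).symm⟩
    · rw [toGraph_restrictTo_inside h, funGraph_reachable]
      exact ⟨i, 0, hiter i le_rfl⟩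

theorem mem_closedNbhd {hfin : ∀ v, (G.neighborSet v).Finite} {v w : V} (hv : v ∈ D)
    (h : v = w ∨ G.Adj v w) : w ∈ closedNbhd hfin D := by
  rcases h with rfl | h
  · exact Finset.mem_union_left _ hv
  · exact Finset.mem_union_right _ (Finset.mem_biUnion.2 ⟨v, hv, by simpa using h⟩)

theorem mem_inside_of_notMem_untouched (hfin : ∀ v, (G.neighborSet v).Finite) {e : G.edgeSet}
    (he : e ∉ untouched G D) : e ∈ inside G (closedNbhd hfin D) := by
  obtain ⟨e, heG⟩ := e
  induction e with | _ u v =>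
  rw [mk_mem_untouched] at he
  rw [mk_mem_inside]
  by_cases hu : u ∈ D
  · exact ⟨mem_closedNbhd hu (Or.inl rfl), mem_closedNbhd hu (Or.inr heG)⟩
  · have hv : v ∈ D := by
      by_contra hv
      exact he ⟨hu, hv⟩
    exact ⟨mem_closedNbhd hv (Or.inr (G.adj_symm heG)), mem_closedNbhd hv (Or.inl rfl)⟩

/-- Gluing different trees into `D` does not change the relation on the boundary, since the paths
from the boundary towards the end do not enter `D`. -/
theorem innerRel_glue (hfin : ∀ v, (G.neighborSet v).Finite) (h : IsEndMap ω n)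
    (hn : ∀ v ∉ D, n v ∉ D) {p : D → V} (hpG : ∀ v : D, G.Adj v (p v)) :
    innerRel (closedNbhd hfin D) (restrictTo (inside G (closedNbhd hfin D)) (glue p ω)) =
      {x | x.1 ∈ boundary G (closedNbhd hfin D) ∧ x.2 ∈ boundary G (closedNbhd hfin D) ∧
        ∃ i j, (cut (closedNbhd hfin D) n)^[i] x.1 = (cut (closedNbhd hfin D) n)^[j] x.2} := by
  set S := closedNbhd hfin D with hS
  set m : V → V := fun v => if hv : v ∈ D then p ⟨v, hv⟩ else n v with hm
  have hbd : ∀ v ∈ boundary G S, v ∉ D := fun v ⟨_, w, hw, hvw⟩ hv =>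
    hw (mem_closedNbhd hv (Or.inr hvw))
  have hiter : ∀ v ∉ D, ∀ i, (cut S m)^[i] v = (cut S n)^[i] v ∧ (cut S n)^[i] v ∉ D := by
    intro v hv i
    induction i with
    | zero => exact ⟨rfl, hv⟩
    | succ i ih =>
      rw [Function.iterate_succ_apply', Function.iterate_succ_apply', ih.1]
      have h1 : m ((cut S n)^[i] v) = n ((cut S n)^[i] v) := dif_neg ih.2
      constructor
      · rw [cut, cut, h1]
      · rw [cut]
        split_ifs
        · exact hn _ ih.2
        · exact ih.2
  ext ⟨a, b⟩
  simp only [innerRel, Set.mem_ofPred_eq, restrictTo_restrictTo subset_rfl,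
    toGraph_restrictTo_inside (toGraph_glue hpG h hn), funGraph_reachable]
  refine and_congr_right fun ha => and_congr_right fun hb => ?_
  simp only [← hm, (hiter a (hbd a ha) _).1, (hiter b (hbd b hb) _).1]

end Glue

/-! ### The conditional law of a one-ended forest near a finite set -/

section Gibbs

variable {V : Type*} {G : SimpleGraph V}

theorem measurable_restrictTo (X : Set G.edgeSet) :
    Measurable (restrictTo X : Config G → Config G) := by
  refine measurable_pi_iff.2 fun e => ?_
  by_cases he : e ∈ X
  · simpa only [restrictTo, if_pos he] using measurable_pi_apply e
  · simpa only [restrictTo, if_neg he] using measurable_const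

theorem measurableSet_adj (u v : V) : MeasurableSet {ω : Config G | (toGraph ω).Adj u v} := by
  by_cases h : s(u, v) ∈ G.edgeSet
  · have : {ω : Config G | (toGraph ω).Adj u v} = (fun ω => ω ⟨s(u, v), h⟩) ⁻¹' {true} := by
      ext ω
      exact toGraph_adj.trans ⟨fun ⟨_, h'⟩ => h', fun h' => ⟨h, h'⟩⟩
    rw [this]
    exact measurable_pi_apply _ (measurableSet_singleton _)
  · have : {ω : Config G | (toGraph ω).Adj u v} = ∅ :=
      Set.eq_empty_of_forall_notMem fun ω hω => h (toGraph_le ω hω)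
    rw [this]
    exact MeasurableSet.empty

theorem measurableSet_reachable [Countable V] (u v : V) :
    MeasurableSet {ω : Config G | (toGraph ω).Reachable u v} := by
  have key : ∀ n u, MeasurableSet {ω : Config G | ∃ p : (toGraph ω).Walk u v, p.length = n} := by
    intro n
    induction n with
    | zero =>
      intro u
      by_cases h : u = v
      · subst h
        convert MeasurableSet.univ
        exact Set.eq_univ_of_forall fun ω => ⟨.nil, rfl⟩
      · convert MeasurableSet.empty
        exact Set.eq_empty_of_forall_notMem fun ω ⟨p, hp⟩ =>
          h (SimpleGraph.Walk.eq_of_length_eq_zero hp)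
    | succ n ih =>
      intro u
      have : {ω : Config G | ∃ p : (toGraph ω).Walk u v, p.length = n + 1} =
          ⋃ w, {ω : Config G | (toGraph ω).Adj u w} ∩
            {ω : Config G | ∃ p : (toGraph ω).Walk w v, p.length = n} := by
        ext ω
        simp only [Set.mem_ofPred_eq, Set.mem_iUnion, Set.mem_inter_iff]
        constructor
        · rintro ⟨p, hp⟩
          cases p with
          | nil => simp at hp
          | cons h q => exact ⟨_, h, q, by simpa using hp⟩
        · rintro ⟨w, h, q, hq⟩
          exact ⟨.cons h q, by simpa using hq⟩
      rw [this]
      exact MeasurableSet.iUnion fun w => (measurableSet_adj u w).inter (ih w)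
  have : {ω : Config G | (toGraph ω).Reachable u v} =
      ⋃ n, {ω : Config G | ∃ p : (toGraph ω).Walk u v, p.length = n} := by
    ext ω
    simp only [Set.mem_ofPred_eq, Set.mem_iUnion]
    exact ⟨fun ⟨p⟩ => ⟨_, p, rfl⟩, fun ⟨_, p, _⟩ => ⟨p⟩⟩
  rw [this]
  exact MeasurableSet.iUnion fun n => key n u

theorem measurableSet_escape [Countable V] (D : Finset V) : MeasurableSet (escape G D) := by
  have h : escape G D = ⋂ v : {v // v ∉ D}, ⋂ s : Finset V, ⋃ w : {w // w ∉ s},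
      restrictTo (untouched G D) ⁻¹' {ω | (toGraph ω).Reachable v w} := by
    ext ω
    simp only [escape, Set.mem_ofPred_eq, Set.mem_iInter, Set.mem_iUnion, Set.mem_preimage,
      Subtype.forall, Subtype.exists]
    refine forall₂_congr fun v _ => ⟨fun h s => ?_, fun h hfin => ?_⟩
    · obtain ⟨w, hw, hs⟩ := h.exists_notMem_finset s
      exact ⟨w, hs, hw⟩
    · obtain ⟨w, hs, hw⟩ := h hfin.toFinset
      exact hs (hfin.mem_toFinset.2 hw)
  rw [h]
  exact MeasurableSet.iInter fun v => MeasurableSet.iInter fun s => MeasurableSet.iUnion fun w =>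
    measurable_restrictTo _ (measurableSet_reachable _ _)

theorem measurable_innerRel (S : Finset V) :
    Measurable[_, ⊤] (innerRel S : Config G → Set (V × V)) := by
  have hfin := (finite_inside G S).to_subtype
  set f : (inside G S → Bool) → Set (V × V) := fun σ =>
    innerRel S (fun e => if h : e ∈ inside G S then σ ⟨e, h⟩ else false : Config G) with hf
  have h : (innerRel S : Config G → Set (V × V)) = f ∘ fun ω e => ω e.1 := by
    funext ω
    simp only [hf, Function.comp_apply, innerRel]
    have : restrictTo (inside G S) ω = restrictTo (inside G S)
        (fun e => if e ∈ inside G S then ω e else false : Config G) :=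
      (restrictTo_restrictTo subset_rfl).symm
    rw [this]
    simp only [dite_eq_ite]
  rw [h]
  exact @Measurable.comp _ _ _ _ _ ⊤ _ _ (@measurable_of_finite _ _ _ ⊤ _ _ f)
    (measurable_pi_iff.2 fun e => measurable_pi_apply _)

theorem outerSigma_le (S : Finset V) :
    outerSigma G S ≤ (inferInstance : MeasurableSpace (Forests G)) := by
  refine sup_le ?_ ?_
  · exact ((measurable_restrictTo _).comp measurable_subtype_coe).comap_le
  · exact (Measurable.comp (measurable_innerRel S) measurable_subtype_coe).comap_le

theorem measurableSet_restrictTo_eq [Countable V] (X : Set G.edgeSet) (A : Config G) :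
    MeasurableSet {F : Forests G | restrictTo X F.1 = A} :=
  ((measurable_restrictTo X).comp measurable_subtype_coe) (measurableSet_singleton A)

/-- The weak Gibbs property in terms of measures of sets. -/
theorem WeakGibbs.real_inter_eq [Countable V] {μ : Measure (Forests G)} [IsProbabilityMeasure μ]
    (hμ : WeakGibbs μ) {S : Finset V} {A B : Config G} (hA : IsBoundaryForest S A)
    (hB : IsBoundaryForest S B) (hAB : innerRel S A = innerRel S B) {C : Set (Forests G)}
    (hC : MeasurableSet[outerSigma G S] C) :
    μ.real (C ∩ {F | restrictTo (inside G S) F.1 = A}) =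
      μ.real (C ∩ {F | restrictTo (inside G S) F.1 = B}) := by
  have key : ∀ A : Config G, μ.real (C ∩ {F | restrictTo (inside G S) F.1 = A}) =
      ∫ F in C, (μ⟦{F : Forests G | restrictTo (inside G S) F.1 = A} | outerSigma G S⟧) F ∂μ := by
    intro A
    have hE := measurableSet_restrictTo_eq (inside G S) A
    rw [setIntegral_condExp (outerSigma_le S) ((integrable_const _).indicator hE) hC,
      setIntegral_indicator hE]
    simp
  rw [key, key]
  exact integral_congr_ae (ae_restrict_of_ae (hμ S A B hA hB hAB))

/-- All trees in `D` are equally likely, jointly with any event that depends on the edges away from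
`D` and ensures that no path towards the end enters `D`. -/
theorem WeakGibbs.real_inter_tree_eq [Countable V] {μ : Measure (Forests G)}
    [IsProbabilityMeasure μ] (hμ : WeakGibbs μ) (hend : ∀ᵐ F ∂μ, ∃ n, IsEndMap F.1 n)
    (hfin : ∀ v, (G.neighborSet v).Finite) {D : Finset V} {p q : D → V}
    (hp : p ∈ parents (touchingEdges hfin D) D) (hq : q ∈ parents (touchingEdges hfin D) D)
    {M : Set (Config G)} (hM : MeasurableSet M) (hMesc : M ⊆ escape G D) :
    μ.real {F | restrictTo (untouched G D) F.1 ∈ M ∧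
        restrictTo (untouched G D)ᶜ F.1 = treeConfig p} =
      μ.real {F | restrictTo (untouched G D) F.1 ∈ M ∧
        restrictTo (untouched G D)ᶜ F.1 = treeConfig q} := by
  set S := closedNbhd hfin D with hS
  have hfinite : Finite {e // e ∈ inside G S ∩ untouched G D} :=
    ((finite_inside G S).inter_of_left _).to_subtype
  have := Fintype.ofFinite {e // e ∈ inside G S ∩ untouched G D}
  set κ : Forests G → {e // e ∈ inside G S ∩ untouched G D} → Bool := fun F e => F.1 e with hκ
  have hκm : Measurable κ := measurable_pi_iff.2 fun e =>
    (measurable_pi_apply e.1).comp measurable_subtype_coe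
  have hX : ∀ p : D → V, MeasurableSet {F : Forests G | restrictTo (untouched G D) F.1 ∈ M ∧
      restrictTo (untouched G D)ᶜ F.1 = treeConfig p} := fun p =>
    (((measurable_restrictTo _).comp measurable_subtype_coe) hM).inter
      (measurableSet_restrictTo_eq _ _)
  -- Decompose according to the edges in `S` that do not touch `D`.
  have hsum : ∀ X : Set (Forests G), μ X = ∑ ρ, μ (κ ⁻¹' {ρ} ∩ X) := by
    intro X
    have h1 := sum_measure_preimage_singleton (μ := μ.restrict X) (f := κ) Finset.univ
      (fun ρ _ => hκm (measurableSet_singleton ρ))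
    rw [Finset.coe_univ, Set.preimage_univ, Measure.restrict_apply_univ] at h1
    rw [← h1]
    exact Finset.sum_congr rfl fun ρ _ =>
      Measure.restrict_apply (hκm (measurableSet_singleton ρ))
  have hG : ∀ p ∈ parents (touchingEdges hfin D) D, ∀ v : D, G.Adj v (p v) := fun p hp v =>
    (mem_touchingEdges.1 ((mem_parents.1 hp).1 v)).1
  rw [Measure.real, Measure.real, hsum, hsum {F | _ ∧ restrictTo _ _ = treeConfig q}]
  congr 1
  refine Finset.sum_congr rfl fun ρ _ => ?_
  by_cases hex : ∃ F : Forests G, κ F = ρ ∧ restrictTo (untouched G D) F.1 ∈ M ∧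
      ∃ n, IsEndMap F.1 n
  · obtain ⟨F₀, hF₀, hF₀M, n, hn⟩ := hex
    have hesc : ∀ v ∉ D, n v ∉ D := hn.mem_escape_iff.1
      ((mem_escape_iff_restrictTo subset_rfl).1 (hMesc hF₀M))
    -- The restriction away from `D`, reconstructed from the edges outside of `S`.
    set J : Config G → Config G := fun ω e =>
      if e ∈ untouched G D then (if e ∈ inside G S then F₀.1 e else ω e) else false with hJ
    have hJm : Measurable J := by
      refine measurable_pi_iff.2 fun e => ?_
      by_cases h1 : e ∈ untouched G D <;> by_cases h2 : e ∈ inside G S <;>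
        simp only [hJ, h1, h2, if_true, if_false] <;> fun_prop
    set C : Set (Forests G) := {F | J (restrictTo (inside G S)ᶜ F.1) ∈ M} with hC
    have hCm : MeasurableSet[outerSigma G S] C :=
      le_sup_left (α := MeasurableSpace (Forests G)) _
        ⟨J ⁻¹' M, hJm hM, rfl⟩
    have hset : ∀ p : D → V, κ ⁻¹' {ρ} ∩ {F : Forests G | restrictTo (untouched G D) F.1 ∈ M ∧
        restrictTo (untouched G D)ᶜ F.1 = treeConfig p} =
        C ∩ {F | restrictTo (inside G S) F.1 = restrictTo (inside G S) (glue p F₀.1)} := by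
      intro p
      have hJF : ∀ F : Forests G, (∀ e ∈ inside G S ∩ untouched G D, F.1 e = F₀.1 e) →
          J (restrictTo (inside G S)ᶜ F.1) = restrictTo (untouched G D) F.1 := by
        intro F hF
        funext e
        by_cases h1 : e ∈ untouched G D <;> by_cases h2 : e ∈ inside G S
        · simp [hJ, restrictTo, h1, h2, hF e ⟨h2, h1⟩]
        · simp [hJ, restrictTo, h1, h2]
        · simp [hJ, restrictTo, h1]
        · simp [hJ, restrictTo, h1]
      have hκF : ∀ F : Forests G, κ F = ρ ↔ ∀ e ∈ inside G S ∩ untouched G D, F.1 e = F₀.1 e := by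
        intro F
        rw [← hF₀, funext_iff, Subtype.forall]
      ext F
      simp only [Set.mem_inter_iff, Set.mem_preimage, Set.mem_singleton_iff, Set.mem_ofPred_eq, hC]
      constructor
      · rintro ⟨h1, h2, h3⟩
        rw [hκF] at h1
        refine ⟨(hJF F h1).symm ▸ h2, ?_⟩
        funext e
        by_cases he : e ∈ inside G S
        · rw [restrictTo_apply_of_mem he, restrictTo_apply_of_mem he, glue]
          split_ifs with hD
          · exact h1 e ⟨he, hD⟩
          · rw [← h3, restrictTo_apply_of_mem (show e ∈ (untouched G D)ᶜ from hD)]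
        · rw [restrictTo_apply_of_notMem he, restrictTo_apply_of_notMem he]
      · rintro ⟨h1, h2⟩
        have h4 : ∀ e ∈ inside G S, F.1 e = glue p F₀.1 e := fun e he => by
          have := congrFun h2 e
          rwa [restrictTo_apply_of_mem he, restrictTo_apply_of_mem he] at this
        have h3 : ∀ e ∈ inside G S ∩ untouched G D, F.1 e = F₀.1 e := fun e he => by
          rw [h4 e he.1, glue, if_pos he.2]
        refine ⟨(hκF F).2 h3, hJF F h3 ▸ h1, ?_⟩
        funext e
        by_cases he : e ∈ untouched G D
        · rw [restrictTo_apply_of_notMem (by simpa using he), eq_comm, ← Bool.not_eq_true,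
            treeConfig_eq_true]
          rintro ⟨v, hv⟩
          exact he v (hv ▸ Sym2.mem_mk_left _ _) v.2
        · rw [restrictTo_apply_of_mem (show e ∈ (untouched G D)ᶜ from he),
            h4 e (mem_inside_of_notMem_untouched hfin he), glue, if_neg he]
    have hB : ∀ p ∈ parents (touchingEdges hfin D) D,
        IsBoundaryForest S (restrictTo (inside G S) (glue p F₀.1)) := fun p hp =>
      isBoundaryForest_restrictTo (toGraph_glue (hG p hp) hn hesc)
        (glue_not_periodic (mem_parents.1 hp).2 hn.2.1 hesc)
    have h1 := hμ.real_inter_eq (hB p hp) (hB q hq)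
      ((innerRel_glue hfin hn hesc (hG p hp)).trans (innerRel_glue hfin hn hesc (hG q hq)).symm) hCm
    rw [hset, hset]
    exact (measureReal_eq_measureReal_iff).1 h1
  · -- Almost surely, this case does not occur.
    have hnull : ∀ p : D → V, μ (κ ⁻¹' {ρ} ∩ {F : Forests G | restrictTo (untouched G D) F.1 ∈ M ∧
        restrictTo (untouched G D)ᶜ F.1 = treeConfig p}) = 0 := by
      intro p
      refine measure_mono_null ?_ hend
      rintro F ⟨h1, h2, -⟩ hF
      exact hex ⟨F, h1, h2, hF⟩
    rw [hnull, hnull]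

/-- Given the forest away from `D`, the tree in `D` is a uniform wired spanning tree. -/
theorem WeakGibbs.real_inter_avoid [Countable V] [Infinite V] (hconn : G.Connected)
    {μ : Measure (Forests G)} [IsProbabilityMeasure μ] (hμ : WeakGibbs μ)
    (hend : ∀ᵐ F ∂μ, ∃ n, IsEndMap F.1 n) (hfin : ∀ v, (G.neighborSet v).Finite) {D : Finset V}
    {M : Set (Config G)} (hM : MeasurableSet M) (hMesc : M ⊆ escape G D) {A : Finset G.edgeSet}
    (hA : ∀ e ∈ A, e ∉ untouched G D) :
    μ.real {F | restrictTo (untouched G D) F.1 ∈ M ∧ ∀ e ∈ A, F.1 e = false} =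
      (parents (touchingEdges hfin D \ A.map (Function.Embedding.subtype _)) D).card /
        (parents (touchingEdges hfin D) D).card *
      μ.real {F : Forests G | restrictTo (untouched G D) F.1 ∈ M} := by
  set P := parents (touchingEdges hfin D) D with hP
  have hne : P.Nonempty := nonempty_parents_touchingEdges hconn hfin D
  obtain ⟨p₀, hp₀⟩ := hne
  set c := μ.real {F | restrictTo (untouched G D) F.1 ∈ M ∧
    restrictTo (untouched G D)ᶜ F.1 = treeConfig p₀} with hc
  have hG : ∀ p ∈ P, ∀ v : D, G.Adj v (p v) := fun p hp v =>
    (mem_touchingEdges.1 ((mem_parents.1 hp).1 v)).1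
  have key : ∀ (Q : Finset (D → V)) (W : Set (Forests G)), Q ⊆ P →
      (∀ p ∈ P, ∀ F : Forests G, restrictTo (untouched G D)ᶜ F.1 = treeConfig p →
        (F ∈ W ↔ p ∈ Q)) →
      μ.real ({F | restrictTo (untouched G D) F.1 ∈ M} ∩ W) = Q.card * c := by
    intro Q W hQ hW
    have h1 : ({F : Forests G | restrictTo (untouched G D) F.1 ∈ M} ∩ W : Set (Forests G)) =ᵐ[μ]
        ⋃ p ∈ Q, {F : Forests G | restrictTo (untouched G D) F.1 ∈ M ∧
          restrictTo (untouched G D)ᶜ F.1 = treeConfig p} := by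
      refine Filter.eventuallyEq_set.2 ?_
      filter_upwards [hend] with F ⟨n, hn⟩
      simp only [Set.mem_inter_iff, Set.mem_ofPred_eq, Set.mem_iUnion, exists_prop]
      constructor
      · rintro ⟨hFM, hFW⟩
        obtain ⟨p, hp, hpF⟩ := hn.exists_parents hfin (hn.mem_escape_iff.1
          ((mem_escape_iff_restrictTo subset_rfl).1 (hMesc hFM)))
        exact ⟨p, (hW p hp F hpF).1 hFW, hFM, hpF⟩
      · rintro ⟨p, hp, hFM, hpF⟩
        exact ⟨hFM, (hW p (hQ hp) F hpF).2 hp⟩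
    rw [measureReal_congr h1, measureReal_biUnion_finset]
    · rw [Finset.sum_congr rfl fun p hp => hμ.real_inter_tree_eq hend hfin (hQ hp) hp₀ hM hMesc]
      simp [hc]
    · intro p hp q hq hpq
      refine Set.disjoint_left.2 fun F hF hF' => hpq ?_
      exact treeConfig_injOn (G := G) (mem_parents.1 (hQ hp)).2 (hG p (hQ hp))
        (hF.2.symm.trans hF'.2)
    · exact fun p _ => (((measurable_restrictTo _).comp measurable_subtype_coe) hM).inter
        (measurableSet_restrictTo_eq _ _)
  have h1 := key P Set.univ subset_rfl fun p hp F _ => by simp [hp]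
  have h2 := key (parents (touchingEdges hfin D \ A.map (Function.Embedding.subtype _)) D)
    {F | ∀ e ∈ A, F.1 e = false} (by rw [parents_sdiff_eq]; exact Finset.filter_subset _ _)
    (fun p hp F hF => by
      rw [parents_sdiff_eq, Finset.mem_filter, ← treeConfig_avoid (G := G), ← hF]
      simp only [Set.mem_ofPred_eq, ← hP, hp, true_and]
      refine forall₂_congr fun e he => ?_
      rw [restrictTo_apply_of_mem (show e ∈ (untouched G D)ᶜ from hA e he)])
  rw [Set.inter_univ] at h1
  have h3 : (P.card : ℝ) ≠ 0 := by exact_mod_cast (Finset.card_pos.2 ⟨p₀, hp₀⟩).ne'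
  rw [h1]
  refine Eq.trans h2 ?_
  field_simp

/-- Explore the forest from outside of a large finite set `H`: the largest subset of `H` that no
path towards the end enters is random, but the event that it equals `D` depends only on the edges
away from `D`. Hence the tree in it is a uniform wired spanning tree, whose law is close to its
limit. -/
theorem WeakGibbs.real_avoid_eq [Countable V] [Infinite V] (hconn : G.Connected)
    {μ : Measure (Forests G)} [IsProbabilityMeasure μ] (hμ : WeakGibbs μ)
    (hend : ∀ᵐ F ∂μ, ∃ n, IsEndMap F.1 n) (hfin : ∀ v, (G.neighborSet v).Finite)
    {H : ℕ → Finset V} (hH : IsExhaustion G H) (A : Finset G.edgeSet) {ℓ : ℝ}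
    (hℓ : Tendsto (fun D =>
      ((parents (touchingEdges hfin D \ A.map (Function.Embedding.subtype _)) D).card : ℝ) /
        (parents (touchingEdges hfin D) D).card) atTop (𝓝 ℓ)) :
    μ.real {F : Forests G | ∀ e ∈ A, F.1 e = false} = ℓ := by
  set w : Finset V → ℝ := fun D =>
    ((parents (touchingEdges hfin D \ A.map (Function.Embedding.subtype _)) D).card : ℝ) /
      (parents (touchingEdges hfin D) D).card with hw
  set av : Set (Forests G) := {F | ∀ e ∈ A, F.1 e = false} with hav
  have havm : MeasurableSet av := by
    have : av = ⋂ e ∈ A, (fun F : Forests G => F.1 e) ⁻¹' {false} := by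
      ext F; simp [hav]
    rw [this]
    exact Finset.measurableSet_biInter _ fun e _ =>
      ((measurable_pi_apply e).comp measurable_subtype_coe) (measurableSet_singleton _)
  refine eq_of_abs_sub_le_all fun ε hε => ?_
  obtain ⟨K, hK⟩ := eventually_atTop.1 (Metric.tendsto_nhds.1 hℓ ε hε)
  set K' := K ∪ A.biUnion fun e => (e : Sym2 V).toFinset with hK'
  -- The event that some set between `K'` and `T` is not entered.
  set U : Finset V → Set (Forests G) := fun T =>
    {F | ∃ D, K' ⊆ D ∧ D ⊆ T ∧ F.1 ∈ escape G D} with hU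
  have hesc : ∀ D, MeasurableSet {F : Forests G | F.1 ∈ escape G D} := fun D =>
    measurable_subtype_coe (measurableSet_escape D)
  have hUm : ∀ T, MeasurableSet (U T) := by
    intro T
    have : U T = ⋃ D ∈ {D | K' ⊆ D ∧ D ⊆ T}, {F : Forests G | F.1 ∈ escape G D} := by
      ext F
      simp only [hU, Set.mem_ofPred_eq, Set.mem_iUnion, exists_prop, and_assoc]
    rw [this]
    exact MeasurableSet.biUnion (Set.to_countable _) fun D _ => hesc D
  have hbound : ∀ T, |μ.real av - ℓ| ≤ ε + (1 + |ℓ|) * (1 - μ.real (U T)) := by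
    intro T
    set 𝒟 := T.powerset.filter (K' ⊆ ·) with h𝒟
    have hmem𝒟 : ∀ D, D ∈ 𝒟 ↔ D ⊆ T ∧ K' ⊆ D := fun D => by
      rw [h𝒟, Finset.mem_filter, Finset.mem_powerset]
    -- `E D` is the event that `D` is the largest set in `𝒟` that is not entered. The sets `D'` in
    -- the definition of `M D` contain `D`, so it depends only on the edges that do not touch `D`.
    set M : Finset V → Set (Config G) := fun D =>
      escape G D \ ⋃ D' ∈ 𝒟.filter (D ⊂ ·), escape G D' with hMdef
    have hMm : ∀ D, MeasurableSet (M D) := fun D =>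
      (measurableSet_escape D).diff (Finset.measurableSet_biUnion _ fun D' _ =>
        measurableSet_escape D')
    have hMiff : ∀ D (ω : Config G), restrictTo (untouched G D) ω ∈ M D ↔
        ω ∈ escape G D ∧ ∀ D' ∈ 𝒟, D ⊂ D' → ω ∉ escape G D' := by
      intro D ω
      simp only [hMdef, Set.mem_sdiff, Set.mem_iUnion, Finset.mem_filter, not_exists, exists_prop,
        not_and, and_imp]
      refine and_congr (mem_escape_iff_restrictTo subset_rfl) (forall₃_congr fun D' _ hD' => ?_)
      rw [mem_escape_iff_restrictTo hD'.subset]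
    set E : Finset V → Set (Forests G) := fun D =>
      {F | restrictTo (untouched G D) F.1 ∈ M D} with hE
    have hEm : ∀ D, MeasurableSet (E D) := fun D =>
      ((measurable_restrictTo _).comp measurable_subtype_coe) (hMm D)
    have hUE : U T = ⋃ D ∈ 𝒟, E D := by
      ext F
      simp only [hU, hE, Set.mem_ofPred_eq, Set.mem_iUnion, exists_prop, hMiff]
      constructor
      · rintro ⟨D, hKD, hDT, hD⟩
        obtain ⟨D', hD', hmax⟩ := (𝒟.filter fun D => F.1 ∈ escape G D).exists_maximal
          ⟨D, Finset.mem_filter.2 ⟨(hmem𝒟 D).2 ⟨hDT, hKD⟩, hD⟩⟩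
        obtain ⟨h1, h2⟩ := Finset.mem_filter.1 hD'
        exact ⟨D', h1, h2, fun D'' h3 h4 h5 =>
          h4.2 (hmax (Finset.mem_filter.2 ⟨h3, h5⟩) h4.1)⟩
      · rintro ⟨D, hD, h, -⟩
        exact ⟨D, ((hmem𝒟 D).1 hD).2, ((hmem𝒟 D).1 hD).1, h⟩
    -- Sets that are not entered are closed under unions, so there is at most one maximal set.
    have hdisj : Set.Pairwise (𝒟 : Set (Finset V)) fun D D' => AEDisjoint μ (E D) (E D') := by
      intro D hD D' hD' hne
      refine measure_mono_null ?_ hend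
      rintro F ⟨h1, h2⟩ ⟨n, hn⟩
      rw [hE, Set.mem_ofPred_eq, hMiff] at h1 h2
      have h3 := hn.union_mem_escape h1.1 h2.1
      have h4 : D ∪ D' ∈ 𝒟 := (hmem𝒟 _).2 ⟨Finset.union_subset ((hmem𝒟 D).1 hD).1
        ((hmem𝒟 D').1 hD').1, ((hmem𝒟 D).1 hD).2.trans Finset.subset_union_left⟩
      have h5 : D ∪ D' = D := by
        by_contra h
        exact h1.2 _ h4 (Finset.subset_union_left.ssubset_of_ne (Ne.symm h)) h3
      have h6 : D ∪ D' = D' := by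
        by_contra h
        exact h2.2 _ h4 (Finset.subset_union_right.ssubset_of_ne (Ne.symm h)) h3
      exact hne (h5.symm.trans h6)
    have hsumU : μ.real (U T) = ∑ D ∈ 𝒟, μ.real (E D) := by
      rw [hUE, measureReal_def, measure_biUnion_finset₀ hdisj fun D _ => (hEm D).nullMeasurableSet,
        ENNReal.toReal_sum fun D _ => measure_ne_top _ _]
      rfl
    have hsumA : μ.real (U T ∩ av) = ∑ D ∈ 𝒟, w D * μ.real (E D) := by
      rw [hUE, Set.iUnion₂_inter, measureReal_def, measure_biUnion_finset₀
        (fun D hD D' hD' hne => (hdisj hD hD' hne).mono Set.inter_subset_left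
          Set.inter_subset_left)
        fun D _ => ((hEm D).inter havm).nullMeasurableSet,
        ENNReal.toReal_sum fun D _ => measure_ne_top _ _]
      refine Finset.sum_congr rfl fun D hD => ?_
      refine hμ.real_inter_avoid hconn hend hfin (hMm D) Set.sdiff_subset fun e he hun => ?_
      have h1 : (Quot.out e.1).1 ∈ K' := Finset.mem_union_right _ (Finset.mem_biUnion.2
        ⟨e, he, Sym2.mem_toFinset.2 (Sym2.out_fst_mem _)⟩)
      exact hun _ (Sym2.out_fst_mem _) (((hmem𝒟 D).1 hD).2 h1)
    have h1 : |μ.real (U T ∩ av) - ℓ * μ.real (U T)| ≤ ε := by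
      rw [hsumA, hsumU, Finset.mul_sum, ← Finset.sum_sub_distrib]
      calc _ ≤ ∑ D ∈ 𝒟, |w D * μ.real (E D) - ℓ * μ.real (E D)| := Finset.abs_sum_le_sum_abs _ _
        _ ≤ ∑ D ∈ 𝒟, ε * μ.real (E D) := by
          refine Finset.sum_le_sum fun D hD => ?_
          rw [← sub_mul, abs_mul, abs_of_nonneg (measureReal_nonneg (μ := μ))]
          refine mul_le_mul_of_nonneg_right ?_ measureReal_nonneg
          exact (hK D (Finset.union_subset_left ((hmem𝒟 D).1 hD).2)).le
        _ = ε * μ.real (U T) := by rw [← Finset.mul_sum, hsumU]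
        _ ≤ ε := mul_le_of_le_one_right hε.le measureReal_le_one
    have h2 : μ.real av = μ.real (U T ∩ av) + μ.real (av \ U T) := by
      rw [Set.inter_comm, measureReal_inter_add_sdiff (hUm T)]
    have h3 : μ.real (av \ U T) ≤ 1 - μ.real (U T) := by
      rw [← probReal_compl_eq_one_sub (hUm T)]
      exact measureReal_mono fun F hF => hF.2
    have h4 : (0 : ℝ) ≤ μ.real (av \ U T) := measureReal_nonneg
    have h5 : 0 ≤ 1 - μ.real (U T) := sub_nonneg.2 measureReal_le_one
    calc |μ.real av - ℓ| = |(μ.real (U T ∩ av) - ℓ * μ.real (U T)) + μ.real (av \ U T) +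
          -(ℓ * (1 - μ.real (U T)))| := by rw [h2]; ring_nf
      _ ≤ |μ.real (U T ∩ av) - ℓ * μ.real (U T)| + |μ.real (av \ U T)| +
          |-(ℓ * (1 - μ.real (U T)))| := abs_add_three _ _ _
      _ ≤ ε + (1 - μ.real (U T)) + |ℓ| * (1 - μ.real (U T)) := by
        rw [abs_neg, abs_mul, abs_of_nonneg h4, abs_of_nonneg h5]
        gcongr
      _ = _ := by ring
  have hlim : Tendsto (fun n => μ.real (U (H n))) atTop (𝓝 1) := by
    have hmono : Monotone fun n => U (H n) := by
      rintro m n hmn F ⟨D, h1, h2, h3⟩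
      exact ⟨D, h1, h2.trans (hH.mono hmn), h3⟩
    have hone : μ (⋃ n, U (H n)) = 1 := by
      rw [← mem_ae_iff_prob_eq_one (MeasurableSet.iUnion fun n => hUm _)]
      filter_upwards [hend] with F ⟨n, hn⟩
      obtain ⟨D, hKD, hD⟩ := hn.exists_mem_escape K'
      obtain ⟨N, hN⟩ := (hH.eventually_subset D).exists
      exact Set.mem_iUnion.2 ⟨N, D, hKD, hN, hD⟩
    have := tendsto_measure_iUnion_atTop (μ := μ) hmono
    rw [hone] at this
    exact (ENNReal.tendsto_toReal ENNReal.one_ne_top).comp this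
  have h1 : Tendsto (fun n => ε + (1 + |ℓ|) * (1 - μ.real (U (H n)))) atTop
      (𝓝 (ε + (1 + |ℓ|) * (1 - 1))) :=
    ((hlim.const_sub 1).const_mul _).const_add ε
  rw [sub_self, mul_zero, add_zero] at h1
  exact ge_of_tendsto' h1 fun n => hbound (H n)

end Gibbs

/-! ### Weak convergence -/

section Convergence

variable {V : Type*} {G : SimpleGraph V}

/-- The configurations without the edges in `A` and with the edges in `B`. -/
def edgeCylinder {E : Type*} (A B : Finset E) : Set (E → Bool) :=
  {ω | (∀ e ∈ A, ω e = false) ∧ ∀ e ∈ B, ω e = true}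

theorem isClopen_edgeCylinder {E : Type*} (A B : Finset E) : IsClopen (edgeCylinder A B) := by
  have : edgeCylinder A B = (⋂ e ∈ A, (fun ω : E → Bool => ω e) ⁻¹' {false}) ∩
      ⋂ e ∈ B, (fun ω : E → Bool => ω e) ⁻¹' {true} := by
    ext ω; simp [edgeCylinder]
  rw [this]
  have h (C : Finset E) (b : Bool) : IsClopen (⋂ e ∈ C, (fun ω : E → Bool => ω e) ⁻¹' {b}) :=
    isClopen_biInter_finset fun e _ => (isClopen_discrete _).preimage (continuous_apply e)
  exact (h A false).inter (h B true)

theorem measurableSet_edgeCylinder {E : Type*} [Countable E] (A B : Finset E) :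
    MeasurableSet (edgeCylinder A B) := (isClopen_edgeCylinder A B).isOpen.measurableSet

theorem real_edgeCylinder_insert {E : Type*} [Countable E] (ν : Measure (E → Bool))
    [IsFiniteMeasure ν] (A B : Finset E) (e : E) :
    ν.real (edgeCylinder A (insert e B)) =
      ν.real (edgeCylinder A B) - ν.real (edgeCylinder (insert e A) B) := by
  have h1 : edgeCylinder A B \ edgeCylinder (insert e A) B = edgeCylinder A (insert e B) := by
    ext ω
    simp only [edgeCylinder, Set.mem_sdiff, Set.mem_ofPred_eq, Finset.forall_mem_insert]
    cases ω e <;> simp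
  have h2 : edgeCylinder (insert e A) B ⊆ edgeCylinder A B := fun ω h =>
    ⟨fun f hf => h.1 f (Finset.mem_insert_of_mem hf), h.2⟩
  rw [← h1, measureReal_sdiff h2 (measurableSet_edgeCylinder _ _)]

/-- Measures on configurations converge weakly if the probabilities to avoid finite sets of edges
converge. -/
theorem tendsto_of_tendsto_avoid {E : Type*} [Countable E] {ν : ℕ → ProbabilityMeasure (E → Bool)}
    {ν' : ProbabilityMeasure (E → Bool)}
    (h : ∀ A : Finset E,
      Tendsto (fun n => (ν n : Measure (E → Bool)).real {ω | ∀ e ∈ A, ω e = false}) atTop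
        (𝓝 ((ν' : Measure (E → Bool)).real {ω | ∀ e ∈ A, ω e = false}))) :
    Tendsto ν atTop (𝓝 ν') := by
  have hcyl : ∀ B A : Finset E,
      Tendsto (fun n => (ν n : Measure (E → Bool)).real (edgeCylinder A B)) atTop
        (𝓝 ((ν' : Measure (E → Bool)).real (edgeCylinder A B))) := by
    intro B
    induction B using Finset.induction_on with
    | empty => simpa [edgeCylinder] using h
    | insert e B _ ih =>
      intro A
      simp only [real_edgeCylinder_insert]
      exact (ih A).sub (ih _)
  have hpi : IsPiSystem (Set.range fun p : Finset E × Finset E => edgeCylinder p.1 p.2) := by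
    rintro _ ⟨⟨A, B⟩, rfl⟩ _ ⟨⟨A', B'⟩, rfl⟩ -
    refine ⟨(A ∪ A', B ∪ B'), ?_⟩
    ext ω
    simp only [edgeCylinder, Set.mem_inter_iff, Set.mem_ofPred_eq, Finset.forall_mem_union]
    tauto
  refine hpi.tendsto_probabilityMeasure_of_tendsto_of_mem ?_ ?_ ?_
  · rintro _ ⟨p, rfl⟩
    exact measurableSet_edgeCylinder _ _
  · intro u hu x hx
    obtain ⟨I, t, ht, htu⟩ := isOpen_pi_iff.1 hu x hx
    refine ⟨_, ⟨(I.filter (x · = false), I.filter (x · = true)), rfl⟩,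
      (isClopen_edgeCylinder _ _).isOpen.mem_nhds ?_, fun ω hω => htu fun e he => ?_⟩
    · exact ⟨fun e he => (Finset.mem_filter.1 he).2, fun e he => (Finset.mem_filter.1 he).2⟩
    · have : ω e = x e := by
        cases hx : x e
        · exact hω.1 e (Finset.mem_filter.2 ⟨he, hx⟩)
        · exact hω.2 e (Finset.mem_filter.2 ⟨he, hx⟩)
      rw [this]
      exact (ht e he).2
  · rintro _ ⟨⟨A, B⟩, rfl⟩
    have := hcyl B A
    rw [← NNReal.tendsto_coe]
    exact this

theorem real_uniformSpanningTree [Countable V] {S : Finset V}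
    (hS : (G.induce (S : Set V)).Connected) {r : V} (hr : r ∈ S) (A : Finset G.edgeSet) :
    (uniformSpanningTree G S hS : Measure (Config G)).real {ω | ∀ e ∈ A, ω e = false} =
      (parents (insideEdges G S \ A.map (Function.Embedding.subtype _)) (S.erase r)).card /
        (parents (insideEdges G S) (S.erase r)).card := by
  set P := parents (insideEdges G S) (S.erase r) with hP
  have hinj : Set.InjOn (treeConfig : (↥(S.erase r) → V) → Config G) P := fun p hp q _ h =>
    treeConfig_injOn (mem_parents.1 hp).2
      (fun v => (mem_insideEdges.1 ((mem_parents.1 hp).1 v)).1) h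
  set Q := P.filter fun p => ∀ e ∈ A, (treeConfig p : Config G) e = false with hQ
  have hQ' : parents (insideEdges G S \ A.map (Function.Embedding.subtype _)) (S.erase r) = Q := by
    rw [parents_sdiff_eq, hQ, hP]
    exact Finset.filter_congr fun p _ => (treeConfig_avoid A).symm
  set T : Finset (Config G) := P.image treeConfig with hT
  have h1 : spanningTrees G S = (T : Set (Config G)) := by
    rw [spanningTrees_eq hr, hT, Finset.coe_image]
  have h2 : (T : Set (Config G)) ∩ {ω | ∀ e ∈ A, ω e = false} =
      (Q.image treeConfig : Finset (Config G)) := by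
    ext ω
    simp only [hT, hQ, Finset.coe_image, Set.mem_inter_iff, Set.mem_image, Finset.mem_coe,
      Finset.mem_filter, Set.mem_ofPred_eq]
    constructor
    · rintro ⟨⟨p, hp, rfl⟩, h⟩
      exact ⟨p, ⟨hp, h⟩, rfl⟩
    · rintro ⟨p, ⟨hp, h⟩, rfl⟩
      exact ⟨⟨p, hp, rfl⟩, h⟩
  change (uniformOn (spanningTrees G S)).real _ = _
  rw [measureReal_def, ← uniformOn_inter_self (finite_spanningTrees G S), h1, h2,
    uniformOn_apply_finset, Finset.inter_eq_right.2 (Finset.image_subset_image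
    (Finset.filter_subset _ _)), Finset.card_image_of_injOn (hinj.mono (Finset.coe_subset.2
    (Finset.filter_subset _ _))), Finset.card_image_of_injOn hinj, hQ', ENNReal.toReal_div,
    ENNReal.toReal_natCast, ENNReal.toReal_natCast]

/-- At most one measure on forests has the property that defines `μ_G`. -/
theorem IsUSTLimit.eq [Countable V] {S : ℕ → Finset V} (hS : IsExhaustion G S)
    {ν ν' : ProbabilityMeasure (Forests G)} (h : IsUSTLimit ν) (h' : IsUSTLimit ν') : ν = ν' := by
  have h1 := congrArg (fun ρ : ProbabilityMeasure (Config G) => (ρ : Measure (Config G)))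
    (tendsto_nhds_unique (h S hS) (h' S hS))
  refine Subtype.ext (Measure.ext fun s hs => ?_)
  obtain ⟨t, ht, rfl⟩ := hs
  have h2 := congrArg (fun ρ : Measure (Config G) => ρ t) h1
  simp only [ProbabilityMeasure.toMeasure_map, Measure.map_apply measurable_subtype_coe ht] at h2
  exact h2

end Convergence

end SpanningForest

end

theorem lemma3p1 {V : Type*} [Countable V] [Infinite V] (G : SimpleGraph V)
    (hconn : G.Connected) (hfin : ∀ v, (G.neighborSet v).Finite)
    (hamen : SpanningForest.IsAmenable G) (hquasi : SpanningForest.IsQuasitransitive G)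
    (μ : ProbabilityMeasure (SpanningForest.Forests G))
    (hgibbs : SpanningForest.WeakGibbs (μ : Measure (SpanningForest.Forests G)))
    (hend : ∀ᵐ F ∂(μ : Measure (SpanningForest.Forests G)),
      ∀ c : (SpanningForest.toGraph F.1).ConnectedComponent,
        SpanningForest.numEnds (SpanningForest.toGraph F.1) c = 1) :
    SpanningForest.IsUSTLimit μ ∧
      (μ : Measure (SpanningForest.Forests G)) = SpanningForest.muG G := by
  open SpanningForest in
  obtain ⟨H, hH, -⟩ := id hamen
  have hmap : ∀ᵐ F ∂(μ : Measure (SpanningForest.Forests G)), ∃ n, IsEndMap F.1 n := by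
    filter_upwards [hend] with F hF
    exact exists_next (fun v => (hfin v).subset fun w hw => toGraph_le F.1 hw) F.2.1 F.2.2 hF
  have hlim : IsUSTLimit μ := by
    intro S hS
    refine tendsto_of_tendsto_avoid fun A => ?_
    obtain ⟨ℓ, hℓ, hfree⟩ := exists_limit_avoid hconn hfin hamen hquasi
      (A.map (Function.Embedding.subtype _)) (by
        intro e he
        obtain ⟨e', -, rfl⟩ := Finset.mem_map.1 he
        exact e'.2)
    have hroot : ∀ n, ∃ r, r ∈ S n := fun n => by
      obtain ⟨⟨r, hr⟩⟩ := (hS.connected n).nonempty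
      exact ⟨r, hr⟩
    choose r hr using hroot
    have h1 := hgibbs.real_avoid_eq hconn hmap hfin hH A hℓ
    have h2 : ((μ.map (f := Subtype.val) measurable_subtype_coe.aemeasurable :
        ProbabilityMeasure (Config G)) : Measure (Config G)).real {ω | ∀ e ∈ A, ω e = false} =
        ℓ := by
      rw [← h1, ProbabilityMeasure.toMeasure_map, map_measureReal_apply measurable_subtype_coe]
      · rfl
      · have := measurableSet_edgeCylinder (E := G.edgeSet) A ∅
        simpa only [edgeCylinder, Finset.notMem_empty, false_imp_iff, implies_true, and_true]
          using this
    rw [h2]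
    refine (hfree S r hS hr).congr fun n => ?_
    rw [real_uniformSpanningTree (hS.connected n) (hr n)]
  refine ⟨hlim, ?_⟩
  have hex : ∃ ν : ProbabilityMeasure (Forests G), IsUSTLimit ν := ⟨μ, hlim⟩
  rw [muG, dif_pos hex, hlim.eq hH hex.choose_spec]
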